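/- **Setting.** Let $\mathcal Y=[0,1]^d$ with $d\ge 1$ and the norm $\|\cdot\|_\infty$, let $\mathcal A$ be a finite action set and let $\mathcal N$ be a finite set of agents $(u,\mathbf c)$, each with a utility $u:\mathcal A\times\mathcal Y\to[0,1]$ and $J$ measurable constraints $c_j:\mathcal A\times\mathcal Y\to[-1,1]$. All utilities are linear and $L$-Lipschitz (in $\|\cdot\|_\infty$) in the second argument. In each round $t=1,\dots,T$ an adaptive (possibly randomized) adversary picks a feature $x_t$ and a distribution $Y_t\in\Delta\mathcal Y$; the forecaster picks $\psi_t\in\Delta\mathcal Y$ from $x_t$ and the past $\pi^{<t}=(x_s,p_s,y_s)_{s<t}$; then $p_t\sim\psi_t$ and $y_t\sim Y_t$ are drawn independently given everything that happened before. Fix $\delta\in(0,1)$ and $\tau=4\sqrt{T\ln\frac{|\mathcal A||\mathcal N|JT}{\delta}}$. Each agent runs the elimination algorithm with threshold $\tau$: start with $\widehat{\mathcal A}_1=\mathcal A$; in round $t$ play $a_t=\mathrm{CBR}^u_{\widehat{\mathcal A}_t}(p_t)\in\arg\max_{a\in\widehat{\mathcal A}_t}u(a,p_t)$ (any fixed measurable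 tie-breaking; an arbitrary action if $\widehat{\mathcal A}_t=\emptyset$); put $\widehat{\mathcal A}_{t+1}=\widehat{\mathcal A}_t\setminus\{a_t\}$ if $\sum_{s\le t}\mathbb 1[a_s=a_t]\,c_j(a_t,y_s)>\tau$ for some $j$, and $\widehat{\mathcal A}_{t+1}=\widehat{\mathcal A}_t$ otherwise. An agent's benchmark class is $$\mathcal B=\mathcal A^{\mathbb E[\mathbf c]}_{1:T}=\{a\in\mathcal A:\ \mathbb E_{y\sim Y_t}[c_j(a,y)]\le 0\ \text{ for all } t\in[T],\ j\in[J]\},$$ and its regrets, considered when $\mathcal B\ne\emptyset$, are $$\mathrm{Reg}_{\mathrm{ext}}=\max_{b\in\mathcal B}\sum_{t=1}^T(u(b,y_t)-u(a_t,y_t)),\qquad \mathrm{Reg}_{\mathrm{swap}}=\max_{\phi:\mathcal A\to\mathcal B}\sum_{t=1}^T(u(\phi(a_t),y_t)-u(a_t,y_t)).$$ For $\beta_1:\mathbb R\to\mathbb R$ concave on $[0,\infty)$, the predictions are $(\mathcal N,\beta_1)$-*decision calibrated* if $\big\|\sum_{t}\mathbb 1[a_t=a](p_t-y_t)\big\|_\infty\le\beta_1\big(\sum_t\mathbb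 1[a_t=a]\big)$ for every agent and every $a\in\mathcal A$. The forecaster *Decision-Calibration-Expectation* with learning rate $\eta$ and precision $\varepsilon$ uses the family $\mathcal E$ of $|\mathcal A||\mathcal N|$ events $E(\pi^{<t},x_t,p)=\mathbb 1[\mathrm{CBR}^u_{\widehat{\mathcal A}_t}(p)=a]$, one for each agent and each $a\in\mathcal A$. In round $t$ it forms the probability weights, for $E\in\mathcal E$, $i\in[d]$, $\sigma\in\{\pm1\}$, $$q_t^{E,i,\sigma}\propto\exp\Big(\tfrac{\eta}{2}\sum_{s<t}\sigma\,\mathbb E_{p\sim\psi_s}\big[E(\pi^{<s},x_s,p)(p^i-y_s^i)\big]\Big)$$ and outputs a $\psi_t\in\Delta\mathcal Y$ that minimizes $\max_{y\in\mathcal Y}\mathbb E_{p\sim\psi}\big[\sum_{E,i,\sigma}q_t^{E,i,\sigma}\,\sigma\,E(\pi^{<t},x_t,p)(p^i-y^i)\big]$ over $\psi\in\Delta\mathcal Y$ up to an additive error $\varepsilon$. **Theorem.** 1. For every forecaster and adversary and every such $\beta_1$, with probability at least $1-\delta$: if the predictions are $(\mathcal N,\beta_1)$-decision calibrated, then every agent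 with $\mathcal B\neq\emptyset$ has $\mathrm{Reg}_{\mathrm{swap}}\le 2L|\mathcal A|\,\beta_1(T/|\mathcal A|)$. 2. There are a universal constant $C>0$ and values $\eta>0$, $\varepsilon_0>0$ depending only on $d$, $|\mathcal A||\mathcal N|$ and $T$ such that Decision-Calibration-Expectation with learning rate $\eta$ and precision $\varepsilon$ exists for every $\varepsilon>0$, and for every $\varepsilon\le\varepsilon_0$ (including $\varepsilon=0$, whenever exact minimizers are used) and every adversary it ensures that, with probability at least $1-\delta$, simultaneously for every agent with $\mathcal B\ne\emptyset$, $$\mathrm{Reg}_{\mathrm{swap}}\le C\,L|\mathcal A|\sqrt{T\ln\tfrac{d|\mathcal A||\mathcal N|T}{\delta}}\qquad\text{and}\qquad \mathrm{Reg}_{\mathrm{ext}}\le C\,L|\mathcal A|\sqrt{T\ln\tfrac{d|\mathcal A||\mathcal N|T}{\delta}}.$$ -/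

import Mathlib

open MeasureTheory ProbabilityTheory

noncomputable section

namespace ConstrainedOmni

/-! ### Outcomes, agents, constrained best responses -/

/-- The prediction / outcome space `[0,1]^d`; `Fin d → ℝ` carries the sup norm. -/
abbrev Outcome (d : ℕ) : Type := ↥(Set.Icc (0 : Fin d → ℝ) 1)

/-- An agent: a utility with values in `[0,1]` and `J` constraints with values in `[-1,1]`. -/
structure Agent (A : Type*) (d J : ℕ) where
  u : A → Outcome d → ℝ
  c : Fin J → A → Outcome d → ℝ
  u_mem : ∀ a y, u a y ∈ Set.Icc (0 : ℝ) 1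
  c_mem : ∀ j a y, c j a y ∈ Set.Icc (-1 : ℝ) 1
  c_measurable : ∀ j a, Measurable (c j a)

/-- `u(a, ·)` is linear: it respects every linear combination that stays in `[0,1]^d`. -/
def LinearUtility {A : Type*} {d : ℕ} (u : A → Outcome d → ℝ) : Prop :=
  ∀ (a : A) (k₁ k₂ : ℝ) (y₁ y₂ y : Outcome d),
    (y : Fin d → ℝ) = k₁ • (y₁ : Fin d → ℝ) + k₂ • (y₂ : Fin d → ℝ) →
      u a y = k₁ * u a y₁ + k₂ * u a y₂

/-- `u(a, ·)` is `L`-Lipschitz in the sup norm. -/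
def LipschitzUtility {A : Type*} {d : ℕ} (L : ℝ) (u : A → Outcome d → ℝ) : Prop :=
  ∀ (a : A) (y₁ y₂ : Outcome d),
    |u a y₁ - u a y₂| ≤ L * ‖(y₁ : Fin d → ℝ) - (y₂ : Fin d → ℝ)‖

/-- A constrained best response `(C, p) ↦ argmax_{a ∈ C} u(a, p)` with some measurable
tie-breaking. If `C` is empty, the action is arbitrary. -/
structure CBR {A : Type*} {d : ℕ} (u : A → Outcome d → ℝ) where
  act : Finset A → Outcome d → A
  act_mem : ∀ C p, C.Nonempty → act C p ∈ C
  act_max : ∀ C p, ∀ b ∈ C, u b p ≤ u (act C p) p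
  act_measurable : ∀ C a, MeasurableSet {p | act C p = a}

/-! ### The elimination algorithm -/

/-- The realized triples (feature, prediction, outcome) of `t` rounds. -/
abbrev Transcript (X : Type*) (d t : ℕ) : Type _ := Fin t → X × Outcome d × Outcome d

/-- The candidate set, and the violation accumulated so far from playing `a`, per constraint. -/
structure ElimState (A : Type*) (J : ℕ) where
  candidates : Finset A
  violation : A → Fin J → ℝ

open Classical in
/-- One round with prediction `p` and outcome `y`: play the constrained best response `a`, add
`c_j(a, y)` to its violations, and eliminate `a` if one of them now exceeds `τ`. -/
def elimStep {A : Type*} {d J : ℕ} (ag : Agent A d J) (br : CBR ag.u) (τ : ℝ)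
    (S : ElimState A J) (p y : Outcome d) : ElimState A J :=
  let a := br.act S.candidates p
  let v : A → Fin J → ℝ := fun b j =>
    if b = a then S.violation b j + ag.c j b y else S.violation b j
  { candidates := if ∃ j, τ < v a j then S.candidates.erase a else S.candidates
    violation := v }

/-- The state of the elimination algorithm with threshold `τ` after `t` rounds. -/
def elimState {A : Type*} [Fintype A] {X : Type*} {d J : ℕ} (ag : Agent A d J) (br : CBR ag.u)
    (τ : ℝ) : (t : ℕ) → Transcript X d t → ElimState A J
  | 0, _ => { candidates := Finset.univ, violation := fun _ _ => 0 }
  | t + 1, h => elimStep ag br τ (elimState ag br τ t (Fin.init h))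
      (h (Fin.last t)).2.1 (h (Fin.last t)).2.2

/-- The action played after the past `h` on receiving the prediction `p`. -/
def elimAction {A : Type*} [Fintype A] {X : Type*} {d J : ℕ} (ag : Agent A d J) (br : CBR ag.u)
    (τ : ℝ) (t : ℕ) (h : Transcript X d t) (p : Outcome d) : A :=
  br.act (elimState ag br τ t h).candidates p

/-- The threshold `4 √(T ln(|A||N|JT/δ))`. -/
def threshold (cardA cardN J T : ℕ) (δ : ℝ) : ℝ :=
  4 * √(T * Real.log ((cardA * cardN * J * T : ℝ) / δ))

/-! ### The interaction -/

/-- A forecaster: in round `t` (counted from `0`), a distribution over predictions that depends on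
the past transcript and the current feature. -/
structure Forecaster (X : Type*) [MeasurableSpace X] (d : ℕ) where
  kernel : (t : ℕ) → Kernel (Transcript X d t × X) (Outcome d)
  markov : ∀ t, IsMarkovKernel (kernel t)

/-- `T` rounds of play of the forecaster `F` against an adaptive, possibly randomized adversary.
`info t` is what is known once the adversary has fixed the feature and the outcome distribution of
round `t`: all past rounds, the current choices, and any private randomness of the adversary.
Given `info t`, prediction and outcome are independent draws from the forecaster's and from the
adversary's distribution. -/
structure Interaction {X : Type*} [MeasurableSpace X] {d : ℕ} (F : Forecaster X d) (T : ℕ)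
    {Ω : Type*} [mΩ : MeasurableSpace Ω] (P : Measure Ω) where
  info : Filtration ℕ mΩ
  feature : ℕ → Ω → X
  prediction : ℕ → Ω → Outcome d
  outcome : ℕ → Ω → Outcome d
  outcomeLaw : ℕ → Ω → Measure (Outcome d)
  feature_measurable : ∀ t < T, Measurable[info t] (feature t)
  prediction_measurable : ∀ t < T, Measurable[info (t + 1)] (prediction t)
  outcome_measurable : ∀ t < T, Measurable[info (t + 1)] (outcome t)
  outcomeLaw_measurable : ∀ t < T, Measurable[info t] (outcomeLaw t)
  outcomeLaw_prob : ∀ t < T, ∀ ω, IsProbabilityMeasure (outcomeLaw t ω)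
  joint_law : ∀ t < T, ∀ S : Set Ω, MeasurableSet[info t] S →
    ∀ B C : Set (Outcome d), MeasurableSet B → MeasurableSet C →
      P (S ∩ prediction t ⁻¹' B ∩ outcome t ⁻¹' C) =
        ∫⁻ ω in S, F.kernel t
          (fun s : Fin t => (feature s ω, prediction s ω, outcome s ω), feature t ω) B *
            outcomeLaw t ω C ∂P

section Play

variable {X : Type*} [MeasurableSpace X] {d : ℕ} {F : Forecaster X d} {T : ℕ}
  {Ω : Type*} [MeasurableSpace Ω] {P : Measure Ω} {A : Type*} [Fintype A] {J : ℕ}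

/-- The realized transcript of the first `t` rounds. -/
def Interaction.history (I : Interaction F T P) (t : ℕ) (ω : Ω) : Transcript X d t :=
  fun s => (I.feature s ω, I.prediction s ω, I.outcome s ω)

/-- The realized action in round `t` of an agent that runs the elimination algorithm. -/
def Interaction.action (I : Interaction F T P) (ag : Agent A d J) (br : CBR ag.u) (τ : ℝ)
    (t : ℕ) (ω : Ω) : A :=
  elimAction ag br τ t (I.history t ω) (I.prediction t ω)

/-- The actions that satisfy every constraint in expectation in every round. -/
def Interaction.benchmark (I : Interaction F T P) (ag : Agent A d J) (ω : Ω) : Set A :=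
  {a | ∀ t < T, ∀ j, ∫ y, ag.c j a y ∂(I.outcomeLaw t ω) ≤ 0}

open Classical in
/-- The realized predictions are decision calibrated with error function `β`: for every agent and
every action, the sup norm of the bias over the rounds in which the agent plays that action is at
most `β` of the number of those rounds. -/
def Interaction.DecisionCalibrated (I : Interaction F T P) {N : Type*} (ag : N → Agent A d J)
    (br : ∀ i, CBR (ag i).u) (τ : ℝ) (β : ℝ → ℝ) (ω : Ω) : Prop :=
  ∀ (i : N) (a : A),
    ‖∑ t ∈ Finset.range T, if I.action (ag i) (br i) τ t ω = a then
        (I.prediction t ω : Fin d → ℝ) - (I.outcome t ω : Fin d → ℝ) else 0‖ ≤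
      β (∑ t ∈ Finset.range T, if I.action (ag i) (br i) τ t ω = a then (1 : ℝ) else 0)

end Play

/-! ### Regret (for finite `A` and nonempty `B` the suprema are maxima) -/

/-- External regret against `B` over `T` rounds. -/
def extRegret {A : Type*} {d : ℕ} (u : A → Outcome d → ℝ) (B : Set A) (T : ℕ)
    (a : ℕ → A) (y : ℕ → Outcome d) : ℝ :=
  ⨆ b : B, ∑ t ∈ Finset.range T, (u (b : A) (y t) - u (a t) (y t))

/-- Swap regret against `B` over `T` rounds. -/
def swapRegret {A : Type*} {d : ℕ} (u : A → Outcome d → ℝ) (B : Set A) (T : ℕ)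
    (a : ℕ → A) (y : ℕ → Outcome d) : ℝ :=
  ⨆ φ : A → B, ∑ t ∈ Finset.range T, (u (φ (a t) : A) (y t) - u (a t) (y t))

/-! ### The forecaster -/

/-- An event: a function of the past transcript, the current feature and the prediction. -/
abbrev Event (X : Type*) (d : ℕ) : Type _ :=
  (t : ℕ) → Transcript X d t → X → Outcome d → ℝ

section UnbiasedPrediction

variable {X : Type*} [MeasurableSpace X] {d : ℕ} {K : Type*} [Fintype K]

/-- The past bias
`∑_{s<t} σ E_{p ∼ ψ_s}[E(π^{<s}, x_s, p) (pⁱ - y_sⁱ)]`, where `ψ_s` is the distribution that the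
forecaster used in round `s`. The sign `σ` is `1` or `-1`. -/
def pastBias (E : K → Event X d) (F : Forecaster X d) (t : ℕ) (h : Transcript X d t)
    (k : K) (i : Fin d) (σ : ℤˣ) : ℝ :=
  ∑ s : Fin t, ((σ : ℤ) : ℝ) *
    ∫ p, E k s (Fin.take s s.is_lt.le h) (h s).1 p *
        ((p : Fin d → ℝ) i - ((h s).2.2 : Fin d → ℝ) i)
      ∂(F.kernel s (Fin.take s s.is_lt.le h, (h s).1))

/-- The exponential weights `q_t^{E,i,σ} ∝ exp((η/2) · past bias)`. -/
def expWeight (E : K → Event X d) (η : ℝ) (F : Forecaster X d) (t : ℕ) (h : Transcript X d t)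
    (k : K) (i : Fin d) (σ : ℤˣ) : ℝ :=
  Real.exp (η / 2 * pastBias E F t h k i σ) /
    ∑ k' : K, ∑ i' : Fin d, ∑ σ' : ℤˣ, Real.exp (η / 2 * pastBias E F t h k' i' σ')

/-- The worst case over `y` of `E_{p ∼ ψ}[∑_{E,i,σ} q^{E,i,σ} σ E(π^{<t}, x_t, p) (pⁱ - yⁱ)]`. -/
def worstCase (E : K → Event X d) (q : K → Fin d → ℤˣ → ℝ) (t : ℕ) (h : Transcript X d t)
    (x : X) (ψ : Measure (Outcome d)) : ℝ :=
  ⨆ y : Outcome d, ∫ p, (∑ k : K, ∑ i : Fin d, ∑ σ : ℤˣ,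
    q k i σ * ((σ : ℤ) : ℝ) * E k t h x p * ((p : Fin d → ℝ) i - (y : Fin d → ℝ) i)) ∂ψ

/-- `F` is the unbiased-prediction algorithm for the events `E` with learning rate `η`: in every
round it outputs a distribution that solves the minmax problem up to `ε`. The value `ε = 0` is an
exact minimizer, which need not exist when events are discontinuous in the prediction. -/
def IsUnbiasedPrediction (E : K → Event X d) (η ε : ℝ) (T : ℕ) (F : Forecaster X d) : Prop :=
  ∀ t < T, ∀ (h : Transcript X d t) (x : X) (ψ : Measure (Outcome d)), IsProbabilityMeasure ψ →
    worstCase E (expWeight E η F t h) t h x (F.kernel t (h, x)) ≤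
      worstCase E (expWeight E η F t h) t h x ψ + ε

end UnbiasedPrediction

open Classical in
/-- The events "agent `i` plays action `a`". -/
def playEvent (X : Type*) {A : Type*} [Fintype A] {d J : ℕ} {N : Type*} (ag : N → Agent A d J)
    (br : ∀ i, CBR (ag i).u) (τ : ℝ) : N × A → Event X d :=
  fun k t h _ p => if elimAction (ag k.1) (br k.1) τ t h p = k.2 then 1 else 0

/-- Decision-Calibration-Expectation: unbiased prediction for the events "agent `i` plays `a`". -/
def IsDecisionCalibrationExpectation {X : Type*} [MeasurableSpace X] {A : Type*} [Fintype A]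
    {d J : ℕ} {N : Type*} [Fintype N] (ag : N → Agent A d J) (br : ∀ i, CBR (ag i).u)
    (τ η ε : ℝ) (T : ℕ) (F : Forecaster X d) : Prop :=
  IsUnbiasedPrediction (playEvent X ag br τ) η ε T F

end ConstrainedOmni

end

/-! Fix a benchmark action. In every round its constraints have nonpositive conditional mean, so its
accumulated violation is at most a sum of bounded martingale differences. By Azuma–Hoeffding and a
union bound over agents, actions, constraints and times, outside an event of probability at most `δ`
no such sum exceeds `τ`; hence no benchmark action is ever eliminated
(`Interaction.measure_violationEvent_le`, `Interaction.utility_le_of_mem_benchmark`). The union runs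
over all actions, so the benchmark class may be random.

Surviving benchmark actions never beat the played action under the prediction `p_t`. By linearity
and the Lipschitz bound, passing from predictions to outcomes on the rounds where `a` is played
costs at most `L` times the calibration error, once for `a` and once for `φ(a)`. Jensen's inequality
over the actions gives the first claim (`swapRegret_le_of_calibrated`).

For the forecaster, treat every signed coordinate of every event as an expert. Against a known
mixture of outcomes, predicting the mean makes every weighted bias vanish, so separation of convex
sets shows that the minmax value is at most zero (`exists_mem_convexHull_lt`). Exponential weights
then bound all expected biases (`IsUnbiasedPrediction.abs_sum_roundBias_le`), and Azuma–Hoeffding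
carries the bound over to the realized biases (`Interaction.martingaleDiff_biasDeviation`). This is
calibration with a constant `β`, so the first claim applies.

Near-minimizers can be chosen measurably because the events see the past only through finitely many
candidate sets, and the weights may be rounded to a grid (`IsRegularEvents.exists_kernel`). -/

noncomputable section

namespace ConstrainedOmni

/-! ### Linear Lipschitz utilities -/

section Deterministic

variable {A : Type*} {d : ℕ}

/-- Build an outcome from its coordinates. -/
def Outcome.mk (z : Fin d → ℝ) (h : ∀ i, 0 ≤ z i ∧ z i ≤ 1) : Outcome d :=
  ⟨z, fun i => (h i).1, fun i => (h i).2⟩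

lemma Outcome.nonneg (y : Outcome d) (i : Fin d) : 0 ≤ (y : Fin d → ℝ) i := y.2.1 i

lemma Outcome.le_one (y : Outcome d) (i : Fin d) : (y : Fin d → ℝ) i ≤ 1 := y.2.2 i

lemma Outcome.abs_sub_le (p y : Outcome d) (i : Fin d) :
    |(p : Fin d → ℝ) i - (y : Fin d → ℝ) i| ≤ 1 := by
  have := p.nonneg i; have := p.le_one i; have := y.nonneg i; have := y.le_one i
  rw [abs_le]; constructor <;> linarith

/-- Linearity is available only for combinations that stay in the cube. Truncations of `y` to sets
of coordinates do stay there, so coordinates are added one at a time; the coefficients are the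
values at the unit vectors. -/
lemma LinearUtility.exists_coeff {u : A → Outcome d → ℝ} (hu : LinearUtility u) (a : A) :
    ∃ w : Fin d → ℝ, ∀ y : Outcome d, u a y = ∑ i, (y : Fin d → ℝ) i * w i := by
  classical
  let e : Fin d → Outcome d := fun i => Outcome.mk (Pi.single i 1) fun j => by
    by_cases h : j = i
    · subst h; simp
    · simp [h]
  refine ⟨fun i => u a (e i), fun y => ?_⟩
  let tr : Finset (Fin d) → Outcome d := fun S =>
    Outcome.mk (fun i => if i ∈ S then (y : Fin d → ℝ) i else 0) fun i => by
      split_ifs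
      · exact ⟨y.nonneg i, y.le_one i⟩
      · simp
  have key : ∀ S : Finset (Fin d), u a (tr S) = ∑ i ∈ S, (y : Fin d → ℝ) i * u a (e i) := by
    intro S
    induction S using Finset.induction_on with
    | empty =>
      have := hu a 0 0 (tr ∅) (tr ∅) (tr ∅) (by ext i; simp [tr, Outcome.mk])
      simpa using this
    | insert j S hj ih =>
      rw [Finset.sum_insert hj, ← ih]
      have := hu a ((y : Fin d → ℝ) j) 1 (e j) (tr S) (tr (insert j S)) (by
        ext i
        by_cases h : i = j
        · subst h; simp [tr, e, Outcome.mk, hj]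
        · simp [tr, e, Outcome.mk, h])
      simpa using this
  have h1 : tr Finset.univ = y := by
    apply Subtype.ext; ext i; simp [tr, Outcome.mk]
  rw [← key, h1]

lemma LipschitzUtility.nonneg {u : A → Outcome d → ℝ} {L : ℝ} (hd : 0 < d)
    (h : LipschitzUtility L u) (a : A) : 0 ≤ L := by
  have h1 := h a (Outcome.mk (fun _ => 1) (by simp)) (Outcome.mk (fun _ => 0) (by simp))
  have : Nonempty (Fin d) := ⟨⟨0, hd⟩⟩
  have h2 : ‖(fun _ : Fin d => (1 : ℝ)) - (fun _ : Fin d => (0 : ℝ))‖ = 1 := by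
    have : (fun _ : Fin d => (1 : ℝ)) - (fun _ : Fin d => (0 : ℝ)) = fun _ => (1 : ℝ) := by
      ext; simp
    rw [this, pi_norm_const]; simp
  have h3 := (abs_nonneg _).trans h1
  simp only [Outcome.mk] at h3
  rw [h2] at h3
  linarith

/-- After division by its norm, `z` is a difference of two outcomes, namely its rescaled positive
and negative parts, so the Lipschitz bound on the cube reaches all vectors. -/
lemma LipschitzUtility.abs_sum_mul_le {u : A → Outcome d → ℝ} {L : ℝ}
    (h : LipschitzUtility L u) {a : A} {w : Fin d → ℝ}
    (hw : ∀ y : Outcome d, u a y = ∑ i, (y : Fin d → ℝ) i * w i) (z : Fin d → ℝ) :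
    |∑ i, z i * w i| ≤ L * ‖z‖ := by
  rcases eq_or_ne z 0 with rfl | hz
  · simp
  have hpos : 0 < ‖z‖ := norm_pos_iff.2 hz
  have hle : ∀ i, |z i| ≤ ‖z‖ := fun i => norm_le_pi_norm z i
  let y₁ : Outcome d := Outcome.mk (fun i => max (z i) 0 / ‖z‖) fun i =>
    ⟨by positivity, (div_le_one hpos).2 (max_le ((le_abs_self _).trans (hle i)) hpos.le)⟩
  let y₂ : Outcome d := Outcome.mk (fun i => max (-z i) 0 / ‖z‖) fun i =>
    ⟨by positivity, (div_le_one hpos).2 (max_le ((neg_le_abs _).trans (hle i)) hpos.le)⟩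
  have hsub : (y₁ : Fin d → ℝ) - (y₂ : Fin d → ℝ) = ‖z‖⁻¹ • z := by
    ext i
    simp only [y₁, y₂, Outcome.mk, Pi.sub_apply, Pi.smul_apply, smul_eq_mul]
    have : max (z i) 0 - max (-z i) 0 = z i := by
      rcases le_total (z i) 0 with h | h
      · rw [max_eq_right h, max_eq_left (by linarith)]; ring
      · rw [max_eq_left h, max_eq_right (by linarith)]; ring
    rw [← sub_div, this]; field_simp
  have h1 := h a y₁ y₂
  rw [hsub, norm_smul, norm_inv, norm_norm, inv_mul_cancel₀ hpos.ne', hw, hw,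
    ← Finset.sum_sub_distrib] at h1
  have h2 : ∑ i, ((y₁ : Fin d → ℝ) i * w i - (y₂ : Fin d → ℝ) i * w i) =
      ‖z‖⁻¹ * ∑ i, z i * w i := by
    rw [Finset.mul_sum]
    refine Finset.sum_congr rfl fun i _ => ?_
    have := congrFun hsub i
    simp only [Pi.sub_apply, Pi.smul_apply, smul_eq_mul] at this
    rw [← sub_mul, this]; ring
  rw [h2, abs_mul, abs_inv, abs_norm] at h1
  rwa [inv_mul_le_iff₀ hpos, mul_one, mul_comm] at h1

open Classical in
/-- Bias of `u(b, ·)` over the rounds in which `a` is played. -/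
lemma abs_sum_utility_sub_le {u : A → Outcome d → ℝ} {L : ℝ} (hu : LinearUtility u)
    (hL : LipschitzUtility L u) (b a : A) (T : ℕ) (act : ℕ → A) (p y : ℕ → Outcome d) :
    |∑ t ∈ Finset.range T, if act t = a then u b (p t) - u b (y t) else 0| ≤
      L * ‖∑ t ∈ Finset.range T, if act t = a then
        (p t : Fin d → ℝ) - (y t : Fin d → ℝ) else 0‖ := by
  obtain ⟨w, hw⟩ := hu.exists_coeff b
  refine le_trans (le_of_eq ?_) (hL.abs_sum_mul_le hw _)
  congr 1
  simp only [Finset.sum_apply, Finset.sum_mul]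
  rw [Finset.sum_comm]
  refine Finset.sum_congr rfl fun t _ => ?_
  split_ifs
  · rw [hw, hw, ← Finset.sum_sub_distrib]
    exact Finset.sum_congr rfl fun i _ => by simp [sub_mul]
  · simp

lemma sum_concave_le [Fintype A] [Nonempty A] {β : ℝ → ℝ} (hβ : ConcaveOn ℝ (Set.Ici 0) β)
    (n : A → ℝ) (hn : ∀ a, 0 ≤ n a) :
    ∑ a, β (n a) ≤ Fintype.card A * β ((∑ a, n a) / Fintype.card A) := by
  have hc : (0 : ℝ) < Fintype.card A := by exact_mod_cast Fintype.card_pos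
  have h := hβ.le_map_sum (t := Finset.univ) (w := fun _ : A => (Fintype.card A : ℝ)⁻¹) (p := n)
    (fun _ _ => by positivity) (by simp [hc.ne']) (fun a _ => hn a)
  simp only [smul_eq_mul, ← Finset.mul_sum] at h
  rw [inv_mul_le_iff₀ hc] at h
  rwa [div_eq_inv_mul]

-- The rounds are split by the played action `a`. Under predictions the swap to `φ a` gains nothing;
-- replacing predictions by outcomes costs a calibration error for `φ a` and one for `a`, whence the
-- factor 2. The counts sum to `T`, and concavity averages them.
open Classical in
theorem swapRegret_le_of_calibrated [Fintype A] {u : A → Outcome d → ℝ} {L : ℝ} (hd : 0 < d)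
    (hu : LinearUtility u) (hL : LipschitzUtility L u) {B : Set A} (hB : B.Nonempty) (T : ℕ)
    (act : ℕ → A) (p y : ℕ → Outcome d)
    (hbr : ∀ t < T, ∀ b ∈ B, u b (p t) ≤ u (act t) (p t)) {β : ℝ → ℝ}
    (hβ : ConcaveOn ℝ (Set.Ici 0) β)
    (hcal : ∀ a, ‖∑ t ∈ Finset.range T, if act t = a then
        (p t : Fin d → ℝ) - (y t : Fin d → ℝ) else 0‖ ≤
      β (∑ t ∈ Finset.range T, if act t = a then (1 : ℝ) else 0)) :
    swapRegret u B T act y ≤ 2 * L * Fintype.card A * β (T / Fintype.card A) := by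
  obtain ⟨b₀, hb₀⟩ := hB
  have : Nonempty A := ⟨b₀⟩
  have : Nonempty B := ⟨⟨b₀, hb₀⟩⟩
  have hL0 : 0 ≤ L := hL.nonneg hd b₀
  refine ciSup_le fun φ => ?_
  have hsplit : ∀ f : A → ℕ → ℝ, ∑ t ∈ Finset.range T, f (act t) t =
      ∑ a, ∑ t ∈ Finset.range T, if act t = a then f a t else 0 := by
    intro f
    rw [Finset.sum_comm]
    refine Finset.sum_congr rfl fun t _ => ?_
    simp
  rw [hsplit fun a t => u (φ a) (y t) - u a (y t)]
  have hone : ∀ a, ∑ t ∈ Finset.range T,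
      (if act t = a then u (φ a) (y t) - u a (y t) else 0) ≤
      2 * L * β (∑ t ∈ Finset.range T, if act t = a then (1 : ℝ) else 0) := by
    intro a
    have h1 := abs_sum_utility_sub_le hu hL (φ a : A) a T act p y
    have h2 := abs_sum_utility_sub_le hu hL a a T act p y
    have h3 := mul_le_mul_of_nonneg_left (hcal a) hL0
    have h4 : ∑ t ∈ Finset.range T, (if act t = a then u (φ a) (y t) - u a (y t) else 0) ≤
        -(∑ t ∈ Finset.range T, if act t = a then u (φ a) (p t) - u (φ a) (y t) else 0) +
        ∑ t ∈ Finset.range T, if act t = a then u a (p t) - u a (y t) else 0 := by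
      rw [← Finset.sum_neg_distrib, ← Finset.sum_add_distrib]
      refine Finset.sum_le_sum fun t ht => ?_
      split_ifs with h
      · have := hbr t (Finset.mem_range.1 ht) (φ a) (φ a).2
        rw [h] at this
        linarith
      · simp
    have h5 := (abs_le.1 h1).1
    have h6 := (abs_le.1 h2).2
    linarith
  refine (Finset.sum_le_sum fun a _ => hone a).trans ?_
  rw [← Finset.mul_sum]
  have h7 := sum_concave_le hβ
    (fun a => ∑ t ∈ Finset.range T, if act t = a then (1 : ℝ) else 0)
    (fun a => Finset.sum_nonneg fun t _ => by split_ifs <;> norm_num)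
  rw [← hsplit fun _ _ => (1 : ℝ)] at h7
  simp only [Finset.sum_const, Finset.card_range, nsmul_eq_mul, mul_one] at h7
  calc _ ≤ 2 * L * (Fintype.card A * β (T / Fintype.card A)) := by gcongr
    _ = _ := by ring

/-- Constant maps `φ` recover external regret. -/
theorem extRegret_le_swapRegret [Fintype A] (u : A → Outcome d → ℝ) {B : Set A}
    (hB : B.Nonempty) (T : ℕ) (act : ℕ → A) (y : ℕ → Outcome d) :
    extRegret u B T act y ≤ swapRegret u B T act y := by
  have : Nonempty B := hB.to_subtype
  refine ciSup_le fun b => ?_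
  exact le_ciSup (f := fun φ : A → B =>
    ∑ t ∈ Finset.range T, (u (φ (act t) : A) (y t) - u (act t) (y t)))
    (Set.finite_range _).bddAbove (fun _ => b)

/-- With at most one action the logarithm in the final bound can be arbitrarily small, so this case
is settled separately. -/
lemma swapRegret_eq_zero_of_subsingleton [Subsingleton A] (u : A → Outcome d → ℝ)
    (B : Set A) (T : ℕ) (act : ℕ → A) (y : ℕ → Outcome d) : swapRegret u B T act y = 0 := by
  have : ∀ φ : A → B,
      ∑ t ∈ Finset.range T, (u (φ (act t) : A) (y t) - u (act t) (y t)) = 0 := fun φ =>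
    Finset.sum_eq_zero fun t _ => by
      rw [Subsingleton.elim (φ (act t) : A) (act t), sub_self]
  simp [swapRegret, this]

end Deterministic

/-! ### Elimination keeps the actions whose violations stay below the threshold -/

section Elimination

variable {X : Type*} {d : ℕ} {A : Type*} [Fintype A] {J : ℕ}

-- Turns the recursive state into a sum along the realized play, the form to which concentration
-- applies.
open Classical in
lemma elimState_violation (ag : Agent A d J) (br : CBR ag.u) (τ : ℝ) (x : ℕ → X)
    (p y : ℕ → Outcome d) (a : A) (j : Fin J) (t : ℕ) :
    (elimState ag br τ t (fun s : Fin t => (x s, p s, y s))).violation a j =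
      ∑ s ∈ Finset.range t,
        if elimAction ag br τ s (fun r : Fin s => (x r, p r, y r)) (p s) = a
          then ag.c j a (y s) else 0 := by
  induction t with
  | zero => simp [elimState]
  | succ t ih =>
    rw [Finset.sum_range_succ, ← ih]
    change (elimStep ag br τ (elimState ag br τ t (fun s : Fin t => (x s, p s, y s)))
      (p t) (y t)).violation a j = _
    change (if a = elimAction ag br τ t (fun s : Fin t => (x s, p s, y s)) (p t) then
      (elimState ag br τ t (fun s : Fin t => (x s, p s, y s))).violation a j + ag.c j a (y t)
      else (elimState ag br τ t (fun s : Fin t => (x s, p s, y s))).violation a j) = _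
    by_cases h : a = elimAction ag br τ t (fun s : Fin t => (x s, p s, y s)) (p t)
    · rw [if_pos h, if_pos h.symm]
    · rw [if_neg h, if_neg (Ne.symm h), add_zero]

open Classical in
lemma mem_candidates_of_violation_le (ag : Agent A d J) (br : CBR ag.u) (τ : ℝ) (x : ℕ → X)
    (p y : ℕ → Outcome d) (a : A) (T : ℕ)
    (h : ∀ t ≤ T, ∀ j,
      (elimState ag br τ t (fun s : Fin t => (x s, p s, y s))).violation a j ≤ τ) :
    ∀ t ≤ T, a ∈ (elimState ag br τ t (fun s : Fin t => (x s, p s, y s))).candidates := by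
  intro t
  induction t with
  | zero => intro _; simp [elimState]
  | succ t ih =>
    intro ht
    have h1 := ih (by omega)
    have h2 := h (t + 1) ht
    change ∀ j, (elimStep ag br τ (elimState ag br τ t (fun s : Fin t => (x s, p s, y s)))
      (p t) (y t)).violation a j ≤ τ at h2
    change a ∈ (elimStep ag br τ (elimState ag br τ t (fun s : Fin t => (x s, p s, y s)))
      (p t) (y t)).candidates
    simp only [elimStep, if_true] at h2 ⊢
    split_ifs with hex
    · refine Finset.mem_erase.2 ⟨?_, h1⟩
      rintro rfl
      obtain ⟨j, hj⟩ := hex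
      have := h2 j
      rw [if_pos rfl] at this
      exact absurd this (not_le.2 hj)
    · exact h1

end Elimination

/-! ### Measurability of the elimination algorithm -/

section Measurability

variable {X : Type*} [MeasurableSpace X] {d : ℕ} {A : Type*} [Fintype A] {J : ℕ}

/-- The discrete σ-algebra on a type of finite sets. -/
local instance discreteFinset {A : Type*} : MeasurableSpace (Finset A) := ⊤

local instance {A : Type*} : DiscreteMeasurableSpace (Finset A) := ⟨fun _ => trivial⟩

/-- Candidate sets and actions take countably many values, so measurability can be checked with each
value frozen. -/
lemma measurable_of_discrete_arg {α ι γ : Type*} [MeasurableSpace α] [MeasurableSpace γ]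
    [Countable ι] [MeasurableSpace ι] [DiscreteMeasurableSpace ι] {a : α → ι} (ha : Measurable a)
    {f : ι → α → γ} (hf : ∀ i, Measurable (f i)) : Measurable fun x => f (a x) x := by
  have h : Measurable fun q : ι × α => f q.1 q.2 := measurable_from_prod_countable_right hf
  exact h.comp (ha.prodMk measurable_id)

lemma CBR.measurable_act {u : A → Outcome d → ℝ} (br : CBR u) {α : Type*} [MeasurableSpace α]
    {C : α → Finset A} (hC : Measurable C) {p : α → Outcome d} (hp : Measurable p) :
    Measurable[_, ⊤] fun x => br.act (C x) (p x) := by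
  let _ : MeasurableSpace A := ⊤
  have : DiscreteMeasurableSpace A := ⟨fun _ => trivial⟩
  refine measurable_of_discrete_arg hC (f := fun C x => br.act C (p x)) fun C => ?_
  exact measurable_to_countable' fun a => hp (br.act_measurable C a)

open Classical in
lemma measurable_elimStep (ag : Agent A d J) (br : CBR ag.u) (τ : ℝ) {α : Type*}
    [MeasurableSpace α] {S : α → ElimState A J} (hC : Measurable fun x => (S x).candidates)
    (hV : ∀ a j, Measurable fun x => (S x).violation a j) {p y : α → Outcome d}
    (hp : Measurable p) (hy : Measurable y) :
    (Measurable fun x => (elimStep ag br τ (S x) (p x) (y x)).candidates) ∧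
      ∀ a j, Measurable fun x => (elimStep ag br τ (S x) (p x) (y x)).violation a j := by
  let _ : MeasurableSpace A := ⊤
  have : DiscreteMeasurableSpace A := ⟨fun _ => trivial⟩
  have hact : Measurable fun x => br.act (S x).candidates (p x) := br.measurable_act hC hp
  have hv : ∀ a b j, Measurable fun x =>
      if b = a then (S x).violation b j + ag.c j b (y x) else (S x).violation b j := by
    intro a b j
    split_ifs
    · exact (hV b j).add ((ag.c_measurable j b).comp hy)
    · exact hV b j
  constructor
  · refine measurable_of_discrete_arg hact (f := fun a x =>
      if ∃ j, τ < (if a = a then (S x).violation a j + ag.c j a (y x) else (S x).violation a j)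
      then (S x).candidates.erase a else (S x).candidates) fun a => ?_
    refine Measurable.ite ?_ ?_ hC
    · rw [Set.ofPred_exists]
      exact MeasurableSet.iUnion fun j => measurableSet_lt measurable_const (hv a a j)
    · exact (measurable_of_countable fun C : Finset A => C.erase a).comp hC
  · intro b j
    exact measurable_of_discrete_arg hact (f := fun a x =>
      if b = a then (S x).violation b j + ag.c j b (y x) else (S x).violation b j)
      fun a => hv a b j

lemma measurable_elimState (ag : Agent A d J) (br : CBR ag.u) (τ : ℝ) (t : ℕ) :
    (Measurable fun h : Transcript X d t => (elimState ag br τ t h).candidates) ∧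
      ∀ a j, Measurable fun h : Transcript X d t => (elimState ag br τ t h).violation a j := by
  induction t with
  | zero => exact ⟨measurable_const, fun _ _ => measurable_const⟩
  | succ t ih =>
    have hinit : Measurable fun h : Transcript X d (t + 1) => (Fin.init h : Transcript X d t) :=
      measurable_pi_lambda _ fun s => measurable_pi_apply _
    exact measurable_elimStep ag br τ (ih.1.comp hinit) (fun a j => (ih.2 a j).comp hinit)
      (measurable_pi_apply (Fin.last t)).snd.fst (measurable_pi_apply (Fin.last t)).snd.snd

lemma measurableSet_candidates_eq (ag : Agent A d J) (br : CBR ag.u) (τ : ℝ) (t : ℕ)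
    (C : Finset A) :
    MeasurableSet {h : Transcript X d t | (elimState ag br τ t h).candidates = C} :=
  (measurable_elimState ag br τ t).1 (measurableSet_singleton C)

lemma measurableSet_elimAction_eq (ag : Agent A d J) (br : CBR ag.u) (τ : ℝ) (t : ℕ) (a : A) :
    MeasurableSet {q : Transcript X d t × Outcome d | elimAction ag br τ t q.1 q.2 = a} :=
  br.measurable_act ((measurable_elimState ag br τ t).1.comp measurable_fst) measurable_snd
    (show MeasurableSet[⊤] {a} from trivial)

variable {N : Type*} (ag : N → Agent A d J) (br : ∀ i, CBR (ag i).u) (τ : ℝ)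

lemma measurable_playEvent (k : N × A) (t : ℕ) :
    Measurable fun q : (Transcript X d t × X) × Outcome d =>
      playEvent X ag br τ k t q.1.1 q.1.2 q.2 := by
  exact Measurable.ite ((measurableSet_elimAction_eq (ag k.1) (br k.1) τ t k.2).preimage
    (measurable_fst.fst.prodMk measurable_snd)) measurable_const measurable_const

lemma playEvent_mem {X : Type*} (k : N × A) (t : ℕ) (h : Transcript X d t) (x : X) (p : Outcome d) :
    0 ≤ playEvent X ag br τ k t h x p ∧ playEvent X ag br τ k t h x p ≤ 1 := by
  unfold playEvent; split_ifs <;> simp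

end Measurability

/-! ### The Azuma–Hoeffding inequality -/

section Azuma

/-- On `[-c, c]` the convex exponential lies below its chord. The bound is affine in `x`, and its
linear term will integrate to zero. -/
lemma exp_mul_le_cosh_add {c x : ℝ} (hc : 0 < c) (hx : |x| ≤ c) (θ : ℝ) :
    Real.exp (θ * x) ≤ Real.cosh (θ * c) + Real.sinh (θ * c) / c * x := by
  obtain ⟨h1, h2⟩ := abs_le.1 hx
  have hconv := convexOn_exp.2
  have h := @hconv (θ * c) (Set.mem_univ _) (-(θ * c)) (Set.mem_univ _)
    ((c + x) / (2 * c)) ((c - x) / (2 * c)) (div_nonneg (by linarith) (by linarith)) (div_nonneg (by linarith) (by linarith))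
    (by field_simp; ring)
  simp only [smul_eq_mul] at h
  have e : (c + x) / (2 * c) * (θ * c) + (c - x) / (2 * c) * -(θ * c) = θ * x := by
    field_simp; ring
  rw [e] at h
  refine h.trans (le_of_eq ?_)
  rw [Real.cosh_eq, Real.sinh_eq]
  field_simp
  ring

variable {Ω : Type*} [mΩ : MeasurableSpace Ω] {P : Measure Ω} [IsProbabilityMeasure P]

/-- `D` is a bounded martingale difference up to time `T`; the martingale property is stated as
orthogonality to the bounded functions of the past. -/
structure MartingaleDiff (P : Measure Ω) (ℱ : Filtration ℕ mΩ) (T : ℕ) (c : ℝ)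
    (D : ℕ → Ω → ℝ) : Prop where
  measurable : ∀ t < T, Measurable[ℱ (t + 1)] (D t)
  bound : ∀ t < T, ∀ ω, |D t ω| ≤ c
  orthogonal : ∀ t < T, ∀ Z : Ω → ℝ, Measurable[ℱ t] Z → (∃ K, ∀ ω, |Z ω| ≤ K) →
    ∫ ω, Z ω * D t ω ∂P = 0

variable {ℱ : Filtration ℕ mΩ} {T : ℕ} {c : ℝ} {D : ℕ → Ω → ℝ}

lemma integrable_of_abs_le {f : Ω → ℝ} (hf : Measurable f) {K : ℝ} (hK : ∀ ω, |f ω| ≤ K) :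
    Integrable f P :=
  Integrable.of_bound hf.aestronglyMeasurable K (Filter.Eventually.of_forall hK)

omit [IsProbabilityMeasure P] in
lemma MartingaleDiff.measurable_sum (h : MartingaleDiff P ℱ T c D) {n : ℕ} (hn : n ≤ T) :
    Measurable[ℱ n] fun ω => ∑ t ∈ Finset.range n, D t ω :=
  Finset.measurable_fun_sum _ fun t ht => by
    have := Finset.mem_range.1 ht
    exact (h.measurable t (by omega)).mono (ℱ.mono (by omega)) le_rfl

omit [IsProbabilityMeasure P] in
lemma MartingaleDiff.abs_sum_le (h : MartingaleDiff P ℱ T c D) {n : ℕ} (hn : n ≤ T) (ω : Ω) :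
    |∑ t ∈ Finset.range n, D t ω| ≤ n * c := by
  refine (Finset.abs_sum_le_sum_abs _ _).trans ?_
  refine (Finset.sum_le_card_nsmul _ _ c fun t ht => h.bound t ?_ ω).trans (by simp)
  exact (Finset.mem_range.1 ht).trans_le hn

/-- The exponential of the first `n` differences is a bounded function of the past, hence an
admissible test function; orthogonality kills the `sinh` term, and each round costs a factor `cosh
(θ * c)`. -/
lemma MartingaleDiff.integral_exp_le (h : MartingaleDiff P ℱ T c D) (hc : 0 < c) (θ : ℝ) {n : ℕ}
    (hn : n ≤ T) :
    ∫ ω, Real.exp (θ * ∑ t ∈ Finset.range n, D t ω) ∂P ≤ Real.exp (n * ((θ * c) ^ 2 / 2)) := by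
  have hbd : ∀ n ≤ T, ∀ ω, |Real.exp (θ * ∑ t ∈ Finset.range n, D t ω)| ≤
      Real.exp (|θ| * (n * c)) := by
    intro n hn ω
    rw [Real.abs_exp]
    refine Real.exp_le_exp.2 ((le_abs_self _).trans ?_)
    rw [abs_mul]
    exact mul_le_mul_of_nonneg_left (h.abs_sum_le hn ω) (abs_nonneg _)
  have hms : ∀ n ≤ T, Measurable[ℱ n] fun ω =>
      Real.exp (θ * ∑ t ∈ Finset.range n, D t ω) := fun n hn =>
    Real.measurable_exp.comp ((h.measurable_sum hn).const_mul θ)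
  have hint : ∀ n ≤ T, Integrable (fun ω => Real.exp (θ * ∑ t ∈ Finset.range n, D t ω)) P :=
    fun n hn => integrable_of_abs_le ((hms n hn).mono (ℱ.le n) le_rfl) (hbd n hn)
  induction n with
  | zero => simp
  | succ n ih =>
    have hn' : n ≤ T := by omega
    have hZD : Integrable (fun ω => Real.exp (θ * ∑ t ∈ Finset.range n, D t ω) * D n ω) P := by
      refine Integrable.mul_bdd (c := c) (hint n hn')
        ((h.measurable n hn).mono (ℱ.le _) le_rfl).aestronglyMeasurable
        (Filter.Eventually.of_forall fun ω => h.bound n hn ω)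
    calc ∫ ω, Real.exp (θ * ∑ t ∈ Finset.range (n + 1), D t ω) ∂P
        ≤ ∫ ω, (Real.cosh (θ * c) * Real.exp (θ * ∑ t ∈ Finset.range n, D t ω) +
            Real.sinh (θ * c) / c *
              (Real.exp (θ * ∑ t ∈ Finset.range n, D t ω) * D n ω)) ∂P := by
          refine integral_mono (hint _ hn) ((hint n hn').const_mul _ |>.add (hZD.const_mul _)) ?_
          intro ω
          dsimp only
          rw [Finset.sum_range_succ, mul_add, Real.exp_add]
          have := mul_le_mul_of_nonneg_left (exp_mul_le_cosh_add hc (h.bound n hn ω) θ)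
            (Real.exp_pos (θ * ∑ t ∈ Finset.range n, D t ω)).le
          linarith
      _ = Real.cosh (θ * c) * ∫ ω, Real.exp (θ * ∑ t ∈ Finset.range n, D t ω) ∂P := by
          rw [integral_add ((hint n hn').const_mul _) (hZD.const_mul _), integral_const_mul,
            integral_const_mul, h.orthogonal n hn _ (hms n hn') ⟨_, hbd n hn'⟩, mul_zero, add_zero]
      _ ≤ Real.exp ((θ * c) ^ 2 / 2) * Real.exp (n * ((θ * c) ^ 2 / 2)) :=
          mul_le_mul (Real.cosh_le_exp_half_sq _) (ih hn') (integral_nonneg fun _ =>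
            (Real.exp_pos _).le) (Real.exp_pos _).le
      _ = _ := by rw [← Real.exp_add]; push_cast; ring_nf

/-- The Azuma–Hoeffding inequality. -/
theorem MartingaleDiff.measure_sum_gt_le (h : MartingaleDiff P ℱ T c D) (hc : 0 < c) {n : ℕ}
    (hn : n ≤ T) (hn0 : 0 < T) {l : ℝ} (hl : 0 ≤ l) :
    P {ω | l < ∑ t ∈ Finset.range n, D t ω} ≤
      ENNReal.ofReal (Real.exp (-l ^ 2 / (2 * T * c ^ 2))) := by
  have hT : (0 : ℝ) < T := by exact_mod_cast hn0
  have hnT : (n : ℝ) ≤ T := by exact_mod_cast hn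
  -- This `θ` minimizes `-θ * l + T * (θ * c) ^ 2 / 2`.
  set θ := l / (T * c ^ 2) with hθ
  have hθ0 : 0 ≤ θ := by positivity
  have hint : Integrable (fun ω => Real.exp (θ * ∑ t ∈ Finset.range n, D t ω)) P := by
    refine integrable_of_abs_le (K := Real.exp (|θ| * (n * c)))
      ((Real.measurable_exp.comp ((h.measurable_sum hn).const_mul θ)).mono (ℱ.le n) le_rfl) ?_
    intro ω
    rw [Real.abs_exp]
    refine Real.exp_le_exp.2 ((le_abs_self _).trans ?_)
    rw [abs_mul]
    exact mul_le_mul_of_nonneg_left (h.abs_sum_le hn ω) (abs_nonneg _)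
  have h1 := measure_ge_le_exp_mul_mgf (μ := P)
    (X := fun ω => ∑ t ∈ Finset.range n, D t ω) l hθ0 hint
  have h2 : mgf (fun ω => ∑ t ∈ Finset.range n, D t ω) P θ ≤
      Real.exp (T * ((θ * c) ^ 2 / 2)) :=
    (h.integral_exp_le hc θ hn).trans (Real.exp_le_exp.2 (by gcongr))
  have h3 : P.real {ω | l ≤ ∑ t ∈ Finset.range n, D t ω} ≤
      Real.exp (-l ^ 2 / (2 * T * c ^ 2)) := by
    refine h1.trans ((mul_le_mul_of_nonneg_left h2 (Real.exp_pos _).le).trans (le_of_eq ?_))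
    rw [← Real.exp_add, hθ]
    congr 1
    field_simp
    ring
  calc P {ω | l < ∑ t ∈ Finset.range n, D t ω}
      ≤ P {ω | l ≤ ∑ t ∈ Finset.range n, D t ω} := measure_mono fun ω (hω : l < _) => show l ≤ _ from hω.le
    _ = ENNReal.ofReal (P.real {ω | l ≤ ∑ t ∈ Finset.range n, D t ω}) := by
      rw [Measure.real, ENNReal.ofReal_toReal (measure_ne_top _ _)]
    _ ≤ _ := ENNReal.ofReal_le_ofReal h3

end Azuma

/-! ### The conditional law of prediction and outcome -/

section JointLaw

/-- Measurable rectangles determine a law, so `(g, p, y)` is distributed as the law of `g` followed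
by the product kernel. -/
lemma integral_of_joint_law {Ω Ω' O : Type*} [MeasurableSpace Ω] [MeasurableSpace Ω']
    [MeasurableSpace O] {P : Measure Ω} [IsProbabilityMeasure P] {g : Ω → Ω'} (hg : Measurable g)
    (κ₁ κ₂ : Kernel Ω' O) [IsMarkovKernel κ₁] [IsMarkovKernel κ₂] {p y : Ω → O}
    (hp : Measurable p) (hy : Measurable y)
    (hlaw : ∀ S, MeasurableSet S → ∀ B C, MeasurableSet B → MeasurableSet C →
      P (g ⁻¹' S ∩ p ⁻¹' B ∩ y ⁻¹' C) = ∫⁻ ω in g ⁻¹' S, κ₁ (g ω) B * κ₂ (g ω) C ∂P)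
    {f : Ω' × O × O → ℝ} (hf : Measurable f) {K : ℝ} (hK : ∀ q, |f q| ≤ K) :
    ∫ ω, f (g ω, p ω, y ω) ∂P = ∫ ω, ∫ q, f (g ω, q) ∂((κ₁ ×ₖ κ₂) (g ω)) ∂P := by
  have hgpy : Measurable fun ω => (g ω, p ω, y ω) := hg.prodMk (hp.prodMk hy)
  have hPg : IsProbabilityMeasure (P.map g) := Measure.isProbabilityMeasure_map hg.aemeasurable
  have hPm : IsProbabilityMeasure (P.map fun ω => (g ω, p ω, y ω)) :=
    Measure.isProbabilityMeasure_map hgpy.aemeasurable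
  have hmap : P.map (fun ω => (g ω, p ω, y ω)) = (P.map g) ⊗ₘ (κ₁ ×ₖ κ₂) := by
    refine Measure.ext_prod₃ fun {S B C} hS hB hC => ?_
    rw [Measure.map_apply hgpy (hS.prod (hB.prod hC)),
      Measure.compProd_apply_prod hS (hB.prod hC), setLIntegral_map hS
        (Kernel.measurable_coe _ (hB.prod hC)) hg]
    have := hlaw S hS B C hB hC
    simp only [Kernel.prod_apply_prod]
    rw [← this]
    congr 1
    ext ω; simp [and_assoc]
  have hint : Integrable f ((P.map g) ⊗ₘ (κ₁ ×ₖ κ₂)) := integrable_of_abs_le hf hK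
  rw [← integral_map hgpy.aemeasurable (f := f) hf.aestronglyMeasurable, hmap,
    Measure.integral_compProd hint, integral_map hg.aemeasurable
      (hf.stronglyMeasurable.integral_kernel_prod_right' (κ := κ₁ ×ₖ κ₂)).aestronglyMeasurable]

end JointLaw

section JointLaw

lemma integral_mul_eq_zero_of_joint_law {Ω Ω' O : Type*} [MeasurableSpace Ω]
    [mΩ' : MeasurableSpace Ω']
    [MeasurableSpace O] {P : Measure Ω} [IsProbabilityMeasure P] {g : Ω → Ω'} (hg : Measurable g)
    (κ₁ κ₂ : Kernel Ω' O) [IsMarkovKernel κ₁] [IsMarkovKernel κ₂] {p y : Ω → O}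
    (hp : Measurable p) (hy : Measurable y)
    (hlaw : ∀ S, MeasurableSet S → ∀ B C, MeasurableSet B → MeasurableSet C →
      P (g ⁻¹' S ∩ p ⁻¹' B ∩ y ⁻¹' C) = ∫⁻ ω in g ⁻¹' S, κ₁ (g ω) B * κ₂ (g ω) C ∂P)
    {f : Ω' × O × O → ℝ} (hf : Measurable f) {K : ℝ} (hK : ∀ q, |f q| ≤ K)
    (h0 : ∀ ω', ∫ q, f (ω', q) ∂((κ₁ ω').prod (κ₂ ω')) = 0)
    {Z : Ω' → ℝ} (hZ : Measurable Z) {M : ℝ} (hM : ∀ ω', |Z ω'| ≤ M) :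
    ∫ ω, Z (g ω) * f (g ω, p ω, y ω) ∂P = 0 := by
  rw [integral_of_joint_law hg κ₁ κ₂ hp hy hlaw (f := fun q => Z q.1 * f q)
    ((hZ.comp measurable_fst).mul hf) (K := M * K) fun q => ?_]
  · simp only [integral_const_mul, Kernel.prod_apply, h0, mul_zero, integral_zero]
  · rw [abs_mul]
    exact mul_le_mul (hM _) (hK _) (abs_nonneg _) ((abs_nonneg _).trans (hM q.1))

end JointLaw

/-! ### Martingale differences from the rounds of play -/

section Interaction

variable {X : Type*} [MeasurableSpace X] {d : ℕ} {F : Forecaster X d} {T : ℕ}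
  {Ω : Type*} [mΩ : MeasurableSpace Ω] {P : Measure Ω}

lemma Interaction.measurable_history (I : Interaction F T P) {t : ℕ} (ht : t ≤ T) :
    Measurable[I.info t] (I.history t) := by
  refine @measurable_pi_lambda _ _ _ (I.info t) _ _ fun s => ?_
  have hs : (s : ℕ) < T := s.is_lt.trans_le ht
  have h1 := (I.feature_measurable s hs).mono (I.info.mono s.is_lt.le) le_rfl
  have h2 := (I.prediction_measurable s hs).mono (I.info.mono (Nat.succ_le_of_lt s.is_lt)) le_rfl
  have h3 := (I.outcome_measurable s hs).mono (I.info.mono (Nat.succ_le_of_lt s.is_lt)) le_rfl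
  exact h1.prodMk (h2.prodMk h3)

lemma Interaction.measurable_context (I : Interaction F T P) {t : ℕ} (ht : t < T) :
    Measurable[I.info t] fun ω => ((I.history t ω, I.feature t ω), I.outcomeLaw t ω) :=
  ((I.measurable_history ht.le).prodMk (I.feature_measurable t ht)).prodMk
    (I.outcomeLaw_measurable t ht)

/-- Functions of the context, the prediction and the outcome of a round whose mean under the
independent draws of the round is zero form a martingale difference. -/
lemma Interaction.martingaleDiff [IsProbabilityMeasure P] (I : Interaction F T P) {c : ℝ}
    (f : ∀ t, ((Transcript X d t × X) × Measure (Outcome d)) × Outcome d × Outcome d → ℝ)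
    (hf : ∀ t < T, Measurable (f t))
    (hc : ∀ t < T, ∀ γ q, IsProbabilityMeasure γ.2 → |f t (γ, q)| ≤ c)
    (h0 : ∀ t < T, ∀ γ, IsProbabilityMeasure γ.2 →
      ∫ q, f t (γ, q) ∂((F.kernel t γ.1).prod γ.2) = 0) :
    MartingaleDiff P I.info T c fun t ω =>
      f t (((I.history t ω, I.feature t ω), I.outcomeLaw t ω), I.prediction t ω,
        I.outcome t ω) where
  measurable t ht := (hf t ht).comp
    (((I.measurable_context ht).mono (I.info.mono t.le_succ) le_rfl).prodMk
      ((I.prediction_measurable t ht).prodMk (I.outcome_measurable t ht)))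
  bound t ht ω := hc t ht _ _ (I.outcomeLaw_prob t ht ω)
  orthogonal t ht Z hZ := by
    rintro ⟨M, hM⟩
    have hctx := I.measurable_context ht
    let κ₁ : @Kernel Ω (Outcome d) (I.info t) _ :=
      @Kernel.comap _ _ _ _ Ω (I.info t) (F.kernel t) (fun ω => (I.history t ω, I.feature t ω))
        hctx.fst
    let κ₂ : @Kernel Ω (Outcome d) (I.info t) _ :=
      @Kernel.mk _ _ (I.info t) _ (I.outcomeLaw t) hctx.snd
    have hF := F.markov t
    have hκ₁ : @IsMarkovKernel _ _ (I.info t) _ κ₁ :=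
      @IsMarkovKernel.mk _ _ (I.info t) _ _ fun ω => hF.isProbabilityMeasure _
    have hκ₂ : @IsMarkovKernel _ _ (I.info t) _ κ₂ :=
      @IsMarkovKernel.mk _ _ (I.info t) _ _ (I.outcomeLaw_prob t ht)
    -- Here `g` is the identity from `Ω` with its full σ-algebra to `Ω` with `I.info t`; the two
    -- kernels then give the conditional laws at each `ω` directly.
    exact integral_mul_eq_zero_of_joint_law (mΩ' := I.info t) (g := id)
      (fun S hS => I.info.le t S hS) κ₁ κ₂
      ((I.prediction_measurable t ht).mono (I.info.le _) le_rfl)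
      ((I.outcome_measurable t ht).mono (I.info.le _) le_rfl)
      (I.joint_law t ht)
      (f := fun q => f t (((I.history t q.1, I.feature t q.1), I.outcomeLaw t q.1), q.2))
      ((hf t ht).comp ((hctx.comp (@measurable_fst _ _ (I.info t) _)).prodMk
        (@measurable_snd _ _ (I.info t) _)))
      (fun q => hc t ht _ _ (I.outcomeLaw_prob t ht q.1))
      (fun ω => h0 t ht ((I.history t ω, I.feature t ω), I.outcomeLaw t ω)
        (I.outcomeLaw_prob t ht ω)) hZ hM

end Interaction

/-! ### Benchmark actions survive with high probability -/

section Violation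

variable {X : Type*} [MeasurableSpace X] {d : ℕ} {F : Forecaster X d} {T : ℕ}
  {Ω : Type*} [mΩ : MeasurableSpace Ω] {P : Measure Ω} {A : Type*} [Fintype A] {J : ℕ}

/-- The left side is visibly a measurable function of the measure `ν`, which makes the conditional
mean of a constraint measurable in the context. -/
lemma lintegral_toReal_sub_one_eq_integral {O : Type*} [MeasurableSpace O] {c : O → ℝ}
    (hc : Measurable c) (hb : ∀ y, c y ∈ Set.Icc (-1 : ℝ) 1) (ν : Measure O)
    [IsProbabilityMeasure ν] :
    (∫⁻ y, ENNReal.ofReal (c y + 1) ∂ν).toReal - 1 = ∫ y, c y ∂ν := by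
  have hi : Integrable c ν := integrable_of_abs_le hc fun y => abs_le.2 (hb y)
  rw [← integral_eq_lintegral_of_nonneg_ae
    (Filter.Eventually.of_forall fun y => by have := (hb y).1; simp; linarith)
    (hc.add_const 1).aestronglyMeasurable, integral_add hi (integrable_const _)]
  simp

-- The indicator depends on the prediction and the centred constraint on the outcome. Given the past
-- these are independent, so the mean factors and its second factor vanishes. Centring enlarges the
-- bound from 1 to 2.
open Classical in
lemma Interaction.measure_constraint_gt_le [IsProbabilityMeasure P] (I : Interaction F T P)
    (ag : Agent A d J) (br : CBR ag.u) (τ : ℝ) (a : A) (j : Fin J) {n : ℕ} (hn : n ≤ T)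
    (hT : 0 < T) {l : ℝ} (hl : 0 ≤ l) :
    P {ω | l < ∑ t ∈ Finset.range n, if I.action ag br τ t ω = a then
        ag.c j a (I.outcome t ω) - ∫ y, ag.c j a y ∂(I.outcomeLaw t ω) else 0} ≤
      ENNReal.ofReal (Real.exp (-l ^ 2 / (2 * T * 2 ^ 2))) := by
  set m : Measure (Outcome d) → ℝ := fun ν =>
    (∫⁻ y, ENNReal.ofReal (ag.c j a y + 1) ∂ν).toReal - 1 with hm
  have hmeas : Measurable m :=
    ((Measure.measurable_lintegral
      ((ag.c_measurable j a).add_const 1).ennreal_ofReal).ennreal_toReal).sub_const 1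
  have hmi : ∀ ν, IsProbabilityMeasure ν → m ν = ∫ y, ag.c j a y ∂ν := fun ν _ =>
    lintegral_toReal_sub_one_eq_integral (ag.c_measurable j a) (ag.c_mem j a) ν
  have hci : ∀ ν : Measure (Outcome d), IsProbabilityMeasure ν → Integrable (ag.c j a) ν :=
    fun ν _ => integrable_of_abs_le (ag.c_measurable j a) fun y => abs_le.2 (ag.c_mem j a y)
  have hmb : ∀ ν, IsProbabilityMeasure ν → |m ν| ≤ 1 := by
    intro ν hν
    rw [hmi ν hν]
    have := norm_integral_le_of_norm_le_const (μ := ν) (f := ag.c j a) (C := 1)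
      (Filter.Eventually.of_forall fun y => abs_le.2 (ag.c_mem j a y))
    simpa using this
  have hD := I.martingaleDiff (c := 2)
    (fun t q => (if elimAction ag br τ t q.1.1.1 q.2.1 = a then (1 : ℝ) else 0) *
      (ag.c j a q.2.2 - m q.1.2)) ?_ ?_ ?_
  · refine (measure_mono fun ω hω => ?_).trans (hD.measure_sum_gt_le two_pos hn hT hl)
    have hlt : l < _ := hω
    refine lt_of_lt_of_eq hlt (Finset.sum_congr rfl fun t ht => ?_)
    have htT : t < T := (Finset.mem_range.1 ht).trans_le hn
    rw [hmi _ (I.outcomeLaw_prob t htT ω), ite_mul, one_mul, zero_mul]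
    rfl
  · intro t _
    refine Measurable.mul (Measurable.ite ?_ measurable_const measurable_const) ?_
    · exact (measurableSet_elimAction_eq ag br τ t a).preimage
        (measurable_fst.fst.fst.prodMk measurable_snd.fst)
    · exact ((ag.c_measurable j a).comp measurable_snd.snd).sub
        (hmeas.comp measurable_fst.snd)
  · intro t _ γ q hγ
    have h1 := hmb _ hγ
    have h2 := ag.c_mem j a q.2
    rw [abs_le] at h1
    split_ifs
    · rw [one_mul, abs_le]; constructor <;> linarith [h1.1, h1.2, h2.1, h2.2]
    · simp
  · intro t _ γ hγ
    have := F.markov t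
    rw [integral_prod_mul (fun p => if elimAction ag br τ t γ.1.1 p = a then (1 : ℝ) else 0)
      (fun y => ag.c j a y - m γ.2), integral_sub (hci _ hγ) (integrable_const _),
      hmi _ hγ]
    simp

variable {N : Type*} [Fintype N]

open Classical in
/-- Some accumulated constraint of some agent exceeds its conditional mean by more than `τ`. -/
def Interaction.violationEvent (I : Interaction F T P) (ag : N → Agent A d J)
    (br : ∀ i, CBR (ag i).u) (τ : ℝ) : Set Ω :=
  ⋃ q : N × A × Fin J × Fin T,
    {ω | τ < ∑ t ∈ Finset.range (q.2.2.2 + 1), if I.action (ag q.1) (br q.1) τ t ω = q.2.1 then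
        (ag q.1).c q.2.2.1 q.2.1 (I.outcome t ω) -
          ∫ y, (ag q.1).c q.2.2.1 q.2.1 y ∂(I.outcomeLaw t ω) else 0}

/-- The threshold makes each of the `M` tails equal to `(δ / M) ^ 2`, since `4 ^ 2 / (2 * 2 ^ 2) =
2`. -/
lemma Interaction.measure_violationEvent_le [IsProbabilityMeasure P] (I : Interaction F T P)
    (ag : N → Agent A d J) (br : ∀ i, CBR (ag i).u) {δ : ℝ} (hδ : 0 < δ) (hδ1 : δ < 1) :
    P (I.violationEvent ag br (threshold (Fintype.card A) (Fintype.card N) J T δ)) ≤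
      ENNReal.ofReal (δ ^ 2 / (Fintype.card A * Fintype.card N * J * T : ℝ)) := by
  set M : ℕ := Fintype.card A * Fintype.card N * J * T with hM
  have hMr : (Fintype.card A * Fintype.card N * J * T : ℝ) = M := by simp [hM]
  have hcard : Fintype.card (N × A × Fin J × Fin T) = M := by simp [hM]; ring
  -- For `M = 0` the union is empty; otherwise `log (M / δ)` is nonnegative, so the square root in
  -- the threshold is not truncated.
  rcases Nat.eq_zero_or_pos M with h0 | hpos
  · have : IsEmpty (N × A × Fin J × Fin T) := Fintype.card_eq_zero_iff.1 (hcard.trans h0)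
    simp [Interaction.violationEvent]
  have hT : 0 < T := Nat.pos_of_ne_zero (by rintro rfl; simp [hM] at hpos)
  have hTr : (0 : ℝ) < T := by exact_mod_cast hT
  have hM1 : (1 : ℝ) ≤ M := by exact_mod_cast hpos
  have hlog : 0 ≤ Real.log (M / δ) :=
    Real.log_nonneg ((one_le_div hδ).2 (by linarith))
  have hτ : threshold (Fintype.card A) (Fintype.card N) J T δ = 4 * √(T * Real.log (M / δ)) := by
    rw [threshold, hMr]
  have hexp : Real.exp (-threshold (Fintype.card A) (Fintype.card N) J T δ ^ 2 /
      (2 * T * 2 ^ 2)) = (δ / M) ^ 2 := by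
    rw [hτ, mul_pow, Real.sq_sqrt (by positivity)]
    have : -(4 ^ 2 * (T * Real.log (M / δ))) / (2 * T * 2 ^ 2) =
        Real.log ((δ / M) ^ 2) := by
      rw [Real.log_pow, Real.log_div hδ.ne' (by positivity), Real.log_div (by positivity) hδ.ne']
      field_simp
      push_cast
      ring
    rw [this, Real.exp_log (by positivity)]
  calc _ ≤ ∑ q : N × A × Fin J × Fin T, ENNReal.ofReal ((δ / M) ^ 2) := by
        refine (measure_iUnion_fintype_le _ _).trans (Finset.sum_le_sum fun q _ => ?_)
        rw [← hexp]
        refine I.measure_constraint_gt_le _ _ _ _ _ (Nat.succ_le_of_lt q.2.2.2.is_lt) hT ?_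
        rw [hτ]; positivity
    _ = ENNReal.ofReal (M * (δ / M) ^ 2) := by
        rw [Finset.sum_const, Finset.card_univ, hcard, nsmul_eq_mul,
          ENNReal.ofReal_mul (by positivity), ENNReal.ofReal_natCast]
    _ = _ := by
        rw [hMr]; congr 1; field_simp

-- Conditional means of a benchmark action are nonpositive, so its violation is at most the centred
-- sum, which stays below `τ` off the event. The action therefore remains a candidate and the best
-- response weakly beats it.
omit [Fintype N] in
lemma Interaction.utility_le_of_mem_benchmark (I : Interaction F T P)
    (ag : N → Agent A d J) (br : ∀ i, CBR (ag i).u) {τ : ℝ} (hτ : 0 ≤ τ) {ω : Ω}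
    (hω : ω ∉ I.violationEvent ag br τ) (i : N) {b : A} (hb : b ∈ I.benchmark (ag i) ω)
    {t : ℕ} (ht : t < T) :
    (ag i).u b (I.prediction t ω) ≤
      (ag i).u (I.action (ag i) (br i) τ t ω) (I.prediction t ω) := by
  classical
  refine (br i).act_max _ _ b ?_
  refine mem_candidates_of_violation_le (ag i) (br i) τ (fun s => I.feature s ω)
    (fun s => I.prediction s ω) (fun s => I.outcome s ω) b T ?_ t ht.le
  rintro (_ | n) hn j
  -- The event covers prefixes of length at least one; the empty prefix needs only `τ ≥ 0`.
  · simpa [elimState] using hτ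
  · rw [elimState_violation (ag i) (br i) τ (fun s => I.feature s ω)
      (fun s => I.prediction s ω) (fun s => I.outcome s ω) b j (n + 1)]
    have hn' : ¬ τ < _ := fun h => hω (Set.mem_iUnion.2 ⟨(i, b, j, ⟨n, by omega⟩), h⟩)
    refine le_trans (Finset.sum_le_sum fun s hs => ?_) (not_lt.1 hn')
    have := hb s (by have := Finset.mem_range.1 hs; omega) j
    change (if I.action (ag i) (br i) τ s ω = b then _ else _) ≤ _
    split_ifs
    · linarith
    · exact le_rfl

lemma threshold_nonneg (a n J T : ℕ) (δ : ℝ) : 0 ≤ threshold a n J T δ := by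
  unfold threshold; positivity

omit [Fintype N] in
/-- Outside the violation event, decision calibration bounds the swap regret of every agent. -/
theorem Interaction.swapRegret_le (I : Interaction F T P) (ag : N → Agent A d J)
    (br : ∀ i, CBR (ag i).u) {L τ : ℝ} (hd : 0 < d) (hlin : ∀ i, LinearUtility (ag i).u)
    (hlip : ∀ i, LipschitzUtility L (ag i).u) (hτ : 0 ≤ τ) {β : ℝ → ℝ}
    (hβ : ConcaveOn ℝ (Set.Ici 0) β) {ω : Ω} (hω : ω ∉ I.violationEvent ag br τ)
    (hcal : I.DecisionCalibrated ag br τ β ω) (i : N)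
    (hB : (I.benchmark (ag i) ω).Nonempty) :
    swapRegret (ag i).u (I.benchmark (ag i) ω) T
        (fun t => I.action (ag i) (br i) τ t ω) (fun t => I.outcome t ω) ≤
      2 * L * Fintype.card A * β (T / Fintype.card A) :=
  swapRegret_le_of_calibrated hd (hlin i) (hlip i) hB T _ (fun t => I.prediction t ω) _
    (fun _ ht _ hb => I.utility_le_of_mem_benchmark ag br hτ hω i hb ht) hβ (hcal i)

end Violation

/-! ### Exponential weights -/

lemma exp_le_one_add_add_sq {x : ℝ} (hx : |x| ≤ 1) : Real.exp x ≤ 1 + x + x ^ 2 := by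
  have := (abs_le.1 (Real.abs_exp_sub_one_sub_id_le hx)).2
  linarith

/-- The potential is the sum of the exponentials. By `exp x ≤ 1 + x + x ^ 2` and the bound on the
weighted gain, it grows per round by at most `exp (η * ε + η ^ 2)`, and it dominates each single
term. -/
theorem exponential_weights_regret {ι : Type*} [Fintype ι] (g : ℕ → ι → ℝ) {η ε : ℝ} {T : ℕ}
    (hη : 0 < η) (hη1 : η ≤ 1) (hg : ∀ t < T, ∀ k, |g t k| ≤ 1)
    (h : ∀ t < T, ∑ k, Real.exp (η * ∑ s ∈ Finset.range t, g s k) * g t k ≤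
      ε * ∑ k, Real.exp (η * ∑ s ∈ Finset.range t, g s k)) (k : ι) :
    ∑ t ∈ Finset.range T, g t k ≤ Real.log (Fintype.card ι) / η + ε * T + η * T := by
  have hΦ : ∀ n ≤ T, ∑ k, Real.exp (η * ∑ s ∈ Finset.range n, g s k) ≤
      Fintype.card ι * Real.exp (n * (η * ε + η ^ 2)) := by
    intro n
    induction n with
    | zero => intro _; simp
    | succ n ih =>
      intro hn
      have hn' : n < T := hn
      calc ∑ k, Real.exp (η * ∑ s ∈ Finset.range (n + 1), g s k)
          ≤ ∑ k, (Real.exp (η * ∑ s ∈ Finset.range n, g s k) * (1 + η ^ 2) +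
              η * (Real.exp (η * ∑ s ∈ Finset.range n, g s k) * g n k)) := by
            refine Finset.sum_le_sum fun k _ => ?_
            have hgk := hg n hn' k
            have h1 : |η * g n k| ≤ 1 := by
              rw [abs_mul, abs_of_pos hη]
              exact mul_le_one₀ hη1 (abs_nonneg _) hgk
            have h2 := exp_le_one_add_add_sq h1
            have h3 : (η * g n k) ^ 2 ≤ η ^ 2 := by
              rw [mul_pow]
              exact mul_le_of_le_one_right (by positivity) ((sq_le_one_iff_abs_le_one _).2 hgk)
            rw [Finset.sum_range_succ, mul_add, Real.exp_add]
            have h4 := mul_le_mul_of_nonneg_left (h2.trans (add_le_add_right h3 _))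
              (Real.exp_pos (η * ∑ s ∈ Finset.range n, g s k)).le
            refine h4.trans (le_of_eq ?_)
            ring
        _ = (∑ k, Real.exp (η * ∑ s ∈ Finset.range n, g s k)) * (1 + η ^ 2) +
              η * ∑ k, Real.exp (η * ∑ s ∈ Finset.range n, g s k) * g n k := by
            rw [Finset.sum_add_distrib, Finset.sum_mul, Finset.mul_sum]
        _ ≤ (∑ k, Real.exp (η * ∑ s ∈ Finset.range n, g s k)) * (1 + η ^ 2) +
              η * (ε * ∑ k, Real.exp (η * ∑ s ∈ Finset.range n, g s k)) := by
            gcongr; exact h n hn'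
        _ = (∑ k, Real.exp (η * ∑ s ∈ Finset.range n, g s k)) * ((η * ε + η ^ 2) + 1) := by ring
        _ ≤ (∑ k, Real.exp (η * ∑ s ∈ Finset.range n, g s k)) * Real.exp (η * ε + η ^ 2) := by
            gcongr
            exact Real.add_one_le_exp _
        _ ≤ (Fintype.card ι * Real.exp (n * (η * ε + η ^ 2))) * Real.exp (η * ε + η ^ 2) := by
            gcongr; exact ih hn'.le
        _ = _ := by rw [mul_assoc, ← Real.exp_add]; push_cast; ring_nf
  have hcard : (0 : ℝ) < Fintype.card ι := by
    have : Nonempty ι := ⟨k⟩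
    exact_mod_cast Fintype.card_pos
  have h1 : Real.exp (η * ∑ s ∈ Finset.range T, g s k) ≤
      Fintype.card ι * Real.exp (T * (η * ε + η ^ 2)) :=
    (Finset.single_le_sum (f := fun k => Real.exp (η * ∑ s ∈ Finset.range T, g s k))
      (fun _ _ => (Real.exp_pos _).le) (Finset.mem_univ k)).trans (hΦ T le_rfl)
  have h2 := Real.log_le_log (Real.exp_pos _) h1
  rw [Real.log_exp, Real.log_mul hcard.ne' (Real.exp_pos _).ne', Real.log_exp] at h2
  rw [← mul_le_mul_iff_right₀ hη]
  refine h2.trans (le_of_eq ?_)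
  field_simp
  ring

/-! ### The minmax problem of the forecaster -/

section Minmax

variable {d : ℕ}

/-- The vertices of the cube. -/
def Outcome.vertex (b : Fin d → Bool) : Outcome d :=
  Outcome.mk (fun i => if b i then 1 else 0) fun i => by split_ifs <;> simp

lemma Outcome.vertex_apply (b : Fin d → Bool) (i : Fin d) :
    (Outcome.vertex b : Fin d → ℝ) i = if b i then 1 else 0 := rfl

/-- If the hull of payoff vectors misses the orthant below `κ`, a separating functional has
nonnegative weights `l` on the vertices. Predicting their `l`-barycentre gives payoff zero, a
contradiction. No continuity of `v` is needed, at the price of the slack `κ`. -/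
lemma exists_mem_convexHull_lt (v : Outcome d → Fin d → ℝ) {κ : ℝ} (hκ : 0 < κ) :
    ∃ z ∈ convexHull ℝ (Set.range fun (p : Outcome d) (b : Fin d → Bool) =>
      ∑ i, v p i * ((p : Fin d → ℝ) i - (Outcome.vertex b : Fin d → ℝ) i)), ∀ b, z b < κ := by
  set G : Outcome d → (Fin d → Bool) → ℝ := fun p b =>
      ∑ i, v p i * ((p : Fin d → ℝ) i - (Outcome.vertex b : Fin d → ℝ) i) with hG
  by_contra hcon
  push Not at hcon
  let U : Set ((Fin d → Bool) → ℝ) := Set.pi Set.univ fun _ => Set.Iio κ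
  have hUo : IsOpen U := isOpen_set_pi Set.finite_univ fun _ _ => isOpen_Iio
  have hUc : Convex ℝ U := convex_pi fun _ _ => convex_Iio κ
  have hdisj : Disjoint U (convexHull ℝ (Set.range G)) := by
    rw [Set.disjoint_left]
    intro z hz hz'
    obtain ⟨b, hb⟩ := hcon z hz'
    exact absurd (hz b (Set.mem_univ b)) (not_lt.2 hb)
  obtain ⟨f, u, hfu, huf⟩ := geometric_hahn_banach_open hUc hUo (convex_convexHull ℝ _) hdisj
  set l : (Fin d → Bool) → ℝ := fun b => f (Pi.single b 1) with hl
  have hf : ∀ z, f z = ∑ b, z b * l b := by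
    intro z
    have := LinearMap.pi_apply_eq_sum_univ (f : ((Fin d → Bool) → ℝ) →ₗ[ℝ] ℝ) z
    simp only [ContinuousLinearMap.coe_coe, smul_eq_mul] at this
    rw [this]
    refine Finset.sum_congr rfl fun b _ => ?_
    simp only [hl]
    congr 2
    ext j; simp [Pi.single_apply, eq_comm]
  have hu : 0 < u := by
    have := hfu 0 (by simp [U, hκ])
    simpa using this
  have hl0 : ∀ b, 0 ≤ l b := by
    intro b
    by_contra hb
    push Not at hb
    -- With a negative weight this point would lie in `U`, while `f` takes there exactly the value
    -- `u`.
    have hmem : (Pi.single b (u / l b) : (Fin d → Bool) → ℝ) ∈ U := by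
      intro b' _
      by_cases h : b' = b
      · subst h
        rw [Pi.single_eq_same]
        exact (div_neg_of_pos_of_neg hu hb).trans hκ
      · rw [Pi.single_eq_of_ne h]
        exact hκ
    have h1 := hfu _ hmem
    rw [hf, Finset.sum_eq_single b (fun b' _ h => by rw [Pi.single_eq_of_ne h, zero_mul])
      (fun h => absurd (Finset.mem_univ b) h), Pi.single_eq_same, div_mul_cancel₀ _ hb.ne] at h1
    exact lt_irrefl _ h1
  have hGu : ∀ p, u ≤ ∑ b, G p b * l b := fun p => by
    rw [← hf]; exact huf _ (subset_convexHull ℝ _ ⟨p, rfl⟩)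
  set Λ := ∑ b, l b with hΛ
  have hΛ0 : 0 ≤ Λ := Finset.sum_nonneg fun b _ => hl0 b
  rcases hΛ0.eq_or_lt with h0 | hpos
  · have hz : ∀ b, l b = 0 := fun b =>
      (Finset.sum_eq_zero_iff_of_nonneg fun b _ => hl0 b).1 h0.symm b (Finset.mem_univ b)
    have := hGu (Outcome.vertex fun _ => true)
    simp only [hz, mul_zero, Finset.sum_const_zero] at this
    linarith
  · have hv0 : ∀ (b : Fin d → Bool) i, 0 ≤ l b * (Outcome.vertex b : Fin d → ℝ) i := fun b i =>
      mul_nonneg (hl0 b) (Outcome.nonneg _ i)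
    let y : Outcome d := Outcome.mk
      (fun i => (∑ b, l b * (Outcome.vertex b : Fin d → ℝ) i) / Λ) fun i =>
        ⟨div_nonneg (Finset.sum_nonneg fun b _ => hv0 b i) hΛ0, (div_le_one hpos).2
          (Finset.sum_le_sum fun b _ => mul_le_of_le_one_right (hl0 b) (Outcome.le_one _ i))⟩
    have hy : ∀ i, (y : Fin d → ℝ) i * Λ = ∑ b, l b * (Outcome.vertex b : Fin d → ℝ) i :=
      fun i => div_mul_cancel₀ _ hpos.ne'
    have h1 : ∑ b, G y b * l b = 0 := by
      simp only [hG, Finset.sum_mul]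
      rw [Finset.sum_comm]
      refine Finset.sum_eq_zero fun i _ => ?_
      have : ∀ b, v y i * ((y : Fin d → ℝ) i - (Outcome.vertex b : Fin d → ℝ) i) * l b =
          v y i * ((y : Fin d → ℝ) i * l b - l b * (Outcome.vertex b : Fin d → ℝ) i) :=
        fun b => by ring
      simp only [this]
      rw [← Finset.mul_sum, Finset.sum_sub_distrib, ← Finset.mul_sum, ← hΛ, hy, sub_self,
        mul_zero]
    have := hGu y
    linarith

/-- A point of the hull is a finite mixture of point masses. Its payoff is affine in `y`, hence
worst at the vertex given by the signs of the mean coefficients `m`. -/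
theorem exists_measure_integral_le (v : Outcome d → Fin d → ℝ) {κ : ℝ} (hκ : 0 < κ) :
    ∃ ψ : Measure (Outcome d), IsProbabilityMeasure ψ ∧ ∀ y : Outcome d,
      ∫ p, ∑ i, v p i * ((p : Fin d → ℝ) i - (y : Fin d → ℝ) i) ∂ψ ≤ κ := by
  obtain ⟨z, hz, hzκ⟩ := exists_mem_convexHull_lt v hκ
  obtain ⟨ι, _, w, g, hw0, hw1, hg, rfl⟩ := mem_convexHull_iff_exists_fintype.1 hz
  choose p hp using hg
  -- Against point masses the integrand need not be measurable.
  have hint : ∀ f : Outcome d → ℝ,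
      ∫ q, f q ∂(∑ k, ENNReal.ofReal (w k) • Measure.dirac (p k)) = ∑ k, w k * f (p k) := by
    intro f
    rw [integral_finsetSum_measure fun k _ => ?_]
    · refine Finset.sum_congr rfl fun k _ => ?_
      rw [integral_smul_measure, integral_dirac, ENNReal.toReal_ofReal (hw0 k), smul_eq_mul]
    · exact (integrable_dirac (by simp)).smul_measure ENNReal.ofReal_ne_top
  refine ⟨∑ k, ENNReal.ofReal (w k) • Measure.dirac (p k), ⟨?_⟩, fun y => ?_⟩
  · simp only [Measure.coe_finsetSum, Measure.coe_smul, Finset.sum_apply, Pi.smul_apply,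
      measure_univ, smul_eq_mul, mul_one]
    rw [← ENNReal.ofReal_sum_of_nonneg fun k _ => hw0 k, hw1, ENNReal.ofReal_one]
  · rw [hint]
    set m : Fin d → ℝ := fun i => ∑ k, w k * v (p k) i with hm
    set b : Fin d → Bool := fun i => decide (m i < 0) with hb
    have key : ∀ y : Outcome d,
        ∑ k, w k * ∑ i, v (p k) i * ((p k : Fin d → ℝ) i - (y : Fin d → ℝ) i) =
          ∑ k, w k * ∑ i, v (p k) i * (p k : Fin d → ℝ) i - ∑ i, m i * (y : Fin d → ℝ) i := by
      intro y
      simp only [hm, Finset.mul_sum, Finset.sum_mul, mul_sub, Finset.sum_sub_distrib]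
      congr 1
      rw [Finset.sum_comm]
      simp only [mul_assoc]
    have h1 := (hzκ b).le
    simp only [Finset.sum_apply, Pi.smul_apply, smul_eq_mul, ← hp] at h1
    rw [key] at h1 ⊢
    refine le_trans (sub_le_sub_left (Finset.sum_le_sum fun i _ => ?_) _) h1
    rw [Outcome.vertex_apply, hb]
    have h2 := y.nonneg i
    have h3 := y.le_one i
    by_cases h : m i < 0
    · simp only [h, decide_true, if_true]; nlinarith
    · simp only [h, decide_false]
      push Not at h
      simpa using mul_nonneg h h2

end Minmax

/-! ### The payoff of the minmax problem and the expected bias -/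

section UnbiasedPrediction

variable {X : Type*} {d : ℕ} {K : Type*}

instance : Nonempty (Outcome d) := ⟨Outcome.mk (fun _ => 0) (by simp)⟩

/-- Events that are measurable in the prediction and take values in `[0,1]`. -/
structure IsRegularEvents (E : K → Event X d) : Prop where
  measurable : ∀ k t h x, Measurable (E k t h x)
  abs_le_one : ∀ k t h x p, |E k t h x p| ≤ 1

variable [Fintype K]

/-- The integrand of the minmax problem. -/
def payoff (E : K → Event X d) (q : K → Fin d → ℤˣ → ℝ) (t : ℕ) (h : Transcript X d t)
    (x : X) (p y : Outcome d) : ℝ :=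
  ∑ k : K, ∑ i : Fin d, ∑ σ : ℤˣ,
    q k i σ * ((σ : ℤ) : ℝ) * E k t h x p * ((p : Fin d → ℝ) i - (y : Fin d → ℝ) i)

variable {E : K → Event X d} {q q' : K → Fin d → ℤˣ → ℝ} {t : ℕ} {h : Transcript X d t} {x : X}

lemma abs_units_cast (σ : ℤˣ) : |((σ : ℤ) : ℝ)| = 1 := by
  rcases Int.units_eq_one_or σ with rfl | rfl <;> simp

lemma payoff_eq_sum (p y : Outcome d) : payoff E q t h x p y =
    ∑ i, (∑ k, ∑ σ : ℤˣ, q k i σ * ((σ : ℤ) : ℝ) * E k t h x p) *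
      ((p : Fin d → ℝ) i - (y : Fin d → ℝ) i) := by
  unfold payoff
  rw [Finset.sum_comm]
  simp only [Finset.sum_mul]

lemma IsRegularEvents.abs_payoff_sub_le (hE : IsRegularEvents E) (p y : Outcome d) :
    |payoff E q t h x p y - payoff E q' t h x p y| ≤ ∑ k, ∑ i, ∑ σ, |q k i σ - q' k i σ| := by
  unfold payoff
  simp only [← Finset.sum_sub_distrib]
  refine (Finset.abs_sum_le_sum_abs _ _).trans (Finset.sum_le_sum fun k _ => ?_)
  refine (Finset.abs_sum_le_sum_abs _ _).trans (Finset.sum_le_sum fun i _ => ?_)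
  refine (Finset.abs_sum_le_sum_abs _ _).trans (Finset.sum_le_sum fun σ _ => ?_)
  rw [← sub_mul, ← sub_mul, ← sub_mul, abs_mul, abs_mul, abs_mul, abs_units_cast, mul_one]
  exact mul_le_of_le_one_right (by positivity) (p.abs_sub_le y i) |>.trans
    (mul_le_of_le_one_right (by positivity) (hE.abs_le_one _ _ _ _ _))

lemma IsRegularEvents.abs_payoff_le (hE : IsRegularEvents E) (p y : Outcome d) :
    |payoff E q t h x p y| ≤ ∑ k, ∑ i, ∑ σ, |q k i σ| := by
  simpa [payoff] using hE.abs_payoff_sub_le (q := q) (q' := 0) (t := t) (h := h) (x := x) p y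

lemma measurable_coord (i : Fin d) : Measurable fun p : Outcome d => (p : Fin d → ℝ) i :=
  (measurable_pi_apply i).comp measurable_subtype_coe

lemma IsRegularEvents.measurable_payoff (hE : IsRegularEvents E) (y : Outcome d) :
    Measurable fun p => payoff E q t h x p y :=
  Finset.measurable_fun_sum _ fun k _ => Finset.measurable_fun_sum _ fun i _ =>
    Finset.measurable_fun_sum _ fun _ _ =>
      ((hE.measurable k t h x).const_mul _).mul ((measurable_coord i).sub_const _)

lemma IsRegularEvents.integrable_payoff (hE : IsRegularEvents E) (y : Outcome d)
    (ψ : Measure (Outcome d)) [IsProbabilityMeasure ψ] :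
    Integrable (fun p => payoff E q t h x p y) ψ :=
  integrable_of_abs_le (hE.measurable_payoff y) fun p => hE.abs_payoff_le p y

lemma IsRegularEvents.abs_integral_payoff_le (hE : IsRegularEvents E) (y : Outcome d)
    (ψ : Measure (Outcome d)) [IsProbabilityMeasure ψ] :
    |∫ p, payoff E q t h x p y ∂ψ| ≤ ∑ k, ∑ i, ∑ σ, |q k i σ| := by
  have := norm_integral_le_of_norm_le_const (μ := ψ)
    (f := fun p => payoff E q t h x p y)
    (Filter.Eventually.of_forall fun p => hE.abs_payoff_le (q := q) (t := t) (h := h) (x := x) p y)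
  simpa using this

lemma IsRegularEvents.integral_payoff_le_worstCase (hE : IsRegularEvents E) (y : Outcome d)
    (ψ : Measure (Outcome d)) [IsProbabilityMeasure ψ] :
    ∫ p, payoff E q t h x p y ∂ψ ≤ worstCase E q t h x ψ :=
  le_ciSup (f := fun y => ∫ p, payoff E q t h x p y ∂ψ)
    ⟨_, by rintro _ ⟨y, rfl⟩; exact (abs_le.1 (hE.abs_integral_payoff_le y ψ)).2⟩ y

lemma IsRegularEvents.le_worstCase (hE : IsRegularEvents E)
    (ψ : Measure (Outcome d)) [IsProbabilityMeasure ψ] :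
    -∑ k, ∑ i, ∑ σ, |q k i σ| ≤ worstCase E q t h x ψ := by
  obtain ⟨y⟩ : Nonempty (Outcome d) := inferInstance
  exact (abs_le.1 (hE.abs_integral_payoff_le y ψ)).1.trans (hE.integral_payoff_le_worstCase y ψ)

/-- Stability in the weights, which lets them be rounded to a grid. -/
lemma IsRegularEvents.worstCase_le_add (hE : IsRegularEvents E)
    (ψ : Measure (Outcome d)) [IsProbabilityMeasure ψ] :
    worstCase E q t h x ψ ≤ worstCase E q' t h x ψ + ∑ k, ∑ i, ∑ σ, |q k i σ - q' k i σ| := by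
  refine ciSup_le fun y => ?_
  have h1 := hE.integral_payoff_le_worstCase (q := q') (t := t) (h := h) (x := x) y ψ
  have h2 : ∫ p, payoff E q t h x p y ∂ψ ≤ ∫ p, (payoff E q' t h x p y +
      ∑ k, ∑ i, ∑ σ, |q k i σ - q' k i σ|) ∂ψ := by
    refine integral_mono (hE.integrable_payoff y ψ)
      ((hE.integrable_payoff y ψ).add (integrable_const _)) fun p => ?_
    have := (abs_le.1 (hE.abs_payoff_sub_le (q := q) (q' := q') (t := t) (h := h) (x := x) p y)).2
    dsimp only
    linarith
  rw [integral_add (hE.integrable_payoff y ψ) (integrable_const _)] at h2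
  simp only [integral_const, probReal_univ, one_smul] at h2
  exact h2.trans (add_le_add_left h1 _)

lemma exists_worstCase_le (E : K → Event X d) (q : K → Fin d → ℤˣ → ℝ) (t : ℕ)
    (h : Transcript X d t) (x : X) {κ : ℝ} (hκ : 0 < κ) :
    ∃ ψ : Measure (Outcome d), IsProbabilityMeasure ψ ∧ worstCase E q t h x ψ ≤ κ := by
  obtain ⟨ψ, hψ, hle⟩ := exists_measure_integral_le
    (fun p i => ∑ k, ∑ σ : ℤˣ, q k i σ * ((σ : ℤ) : ℝ) * E k t h x p) hκ
  refine ⟨ψ, hψ, ciSup_le fun y => ?_⟩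
  have := hle y
  simp only [← payoff_eq_sum] at this
  exact this

/-! ### The expected bias of unbiased prediction -/

/-- The conditional expectation of the bias of round `t` of the event `k` in coordinate `i`. -/
def roundBias [MeasurableSpace X] (E : K → Event X d) (F : Forecaster X d) (x : ℕ → X) (p y : ℕ → Outcome d)
    (t : ℕ) (k : K) (i : Fin d) : ℝ :=
  ∫ r, E k t (fun s : Fin t => (x s, p s, y s)) (x t) r *
    ((r : Fin d → ℝ) i - (y t : Fin d → ℝ) i) ∂(F.kernel t (fun s => (x s, p s, y s), x t))

variable [MeasurableSpace X] {F : Forecaster X d}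

omit [Fintype K] in
lemma pastBias_eq_sum_roundBias (E : K → Event X d) (x : ℕ → X) (p y : ℕ → Outcome d) (t : ℕ)
    (k : K) (i : Fin d) (σ : ℤˣ) :
    pastBias E F t (fun s : Fin t => (x s, p s, y s)) k i σ =
      ∑ s ∈ Finset.range t, ((σ : ℤ) : ℝ) * roundBias E F x p y s k i := by
  rw [Finset.sum_range]
  rfl

omit [MeasurableSpace X] [Fintype K] in
lemma IsRegularEvents.integrable_event (hE : IsRegularEvents E) (k : K) (i : Fin d)
    (y : Outcome d) (ψ : Measure (Outcome d)) [IsProbabilityMeasure ψ] :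
    Integrable (fun r => E k t h x r * ((r : Fin d → ℝ) i - (y : Fin d → ℝ) i)) ψ := by
  refine integrable_of_abs_le
    ((hE.measurable k t h x).mul ((measurable_coord i).sub_const _)) (K := 1) fun r => ?_
  rw [abs_mul]
  exact mul_le_one₀ (hE.abs_le_one _ _ _ _ _) (abs_nonneg _) (r.abs_sub_le y i)

omit [Fintype K] in
lemma IsRegularEvents.abs_roundBias_le (hE : IsRegularEvents E) (x : ℕ → X) (p y : ℕ → Outcome d)
    (t : ℕ) (k : K) (i : Fin d) : |roundBias E F x p y t k i| ≤ 1 := by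
  have := F.markov t
  have h1 := norm_integral_le_of_norm_le_const
    (μ := F.kernel t (fun s => (x s, p s, y s), x t)) (C := 1)
    (f := fun r => E k t (fun s : Fin t => (x s, p s, y s)) (x t) r *
      ((r : Fin d → ℝ) i - (y t : Fin d → ℝ) i)) (Filter.Eventually.of_forall fun r => ?_)
  · simpa [roundBias] using h1
  · rw [Real.norm_eq_abs, abs_mul]
    exact mul_le_one₀ (hE.abs_le_one _ _ _ _ _) (abs_nonneg _) (r.abs_sub_le _ i)

lemma IsRegularEvents.integral_payoff_eq (hE : IsRegularEvents E) (x : ℕ → X)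
    (p y : ℕ → Outcome d) (t : ℕ) :
    ∫ r, payoff E q t (fun s : Fin t => (x s, p s, y s)) (x t) r (y t)
        ∂(F.kernel t (fun s => (x s, p s, y s), x t)) =
      ∑ k, ∑ i, ∑ σ : ℤˣ, q k i σ * ((σ : ℤ) : ℝ) * roundBias E F x p y t k i := by
  have := F.markov t
  unfold payoff
  have hint : ∀ k i (σ : ℤˣ), Integrable (fun r : Outcome d => q k i σ * ((σ : ℤ) : ℝ) *
      E k t (fun s : Fin t => (x s, p s, y s)) (x t) r *
        ((r : Fin d → ℝ) i - (y t : Fin d → ℝ) i))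
        (F.kernel t (fun s => (x s, p s, y s), x t)) := by
    intro k i σ
    simp only [mul_assoc (q k i σ * ((σ : ℤ) : ℝ))]
    exact (hE.integrable_event k i (y t) _).const_mul _
  rw [integral_finsetSum _ fun k _ => integrable_finsetSum _ fun i _ =>
    integrable_finsetSum _ fun σ _ => hint k i σ]
  refine Finset.sum_congr rfl fun k _ => ?_
  rw [integral_finsetSum _ fun i _ => integrable_finsetSum _ fun σ _ => hint k i σ]
  refine Finset.sum_congr rfl fun i _ => ?_
  rw [integral_finsetSum _ fun σ _ => hint k i σ]
  refine Finset.sum_congr rfl fun σ _ => ?_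
  simp only [mul_assoc (q k i σ * ((σ : ℤ) : ℝ))]
  rw [integral_const_mul]
  rfl

/-- The experts are the triples of event, coordinate and sign; the forecaster's worst case bounds
their weighted gain against the actual outcome. The estimate is pathwise, and the two signs give the
absolute value. -/
theorem IsUnbiasedPrediction.abs_sum_roundBias_le (hE : IsRegularEvents E) {η ε : ℝ} {T : ℕ}
    (hη : 0 < η) (hη1 : η / 2 ≤ 1) (hF : IsUnbiasedPrediction E η ε T F) (x : ℕ → X)
    (p y : ℕ → Outcome d) (k : K) (i : Fin d) :
    |∑ t ∈ Finset.range T, roundBias E F x p y t k i| ≤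
      Real.log (Fintype.card K * (d * 2)) / (η / 2) + ε * T + η / 2 * T := by
  set g : ℕ → K × Fin d × ℤˣ → ℝ := fun t q =>
    ((q.2.2 : ℤ) : ℝ) * roundBias E F x p y t q.1 q.2.1 with hg
  have hcard : (Fintype.card (K × Fin d × ℤˣ) : ℝ) = Fintype.card K * (d * 2) := by
    simp [Fintype.card_units_int]
  have hmain := exponential_weights_regret g (η := η / 2) (ε := ε) (T := T) (by positivity) hη1
    (fun t _ q => by
      rw [hg, abs_mul, abs_units_cast, one_mul]; exact hE.abs_roundBias_le x p y t _ _) ?_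
  · rw [hcard] at hmain
    have h1 := hmain (k, i, 1)
    have h2 := hmain (k, i, -1)
    simp only [hg, ← Finset.mul_sum] at h1 h2
    simp only [Units.val_one, Int.cast_one, one_mul, Units.val_neg, Int.cast_neg, neg_mul] at h1 h2
    rw [abs_le]
    constructor <;> linarith
  · intro t ht
    have hmk := F.markov t
    set H : Transcript X d t := fun s : Fin t => (x s, p s, y s) with hH
    have hw : ∀ k i σ, Real.exp (η / 2 * ∑ s ∈ Finset.range t, g s (k, i, σ)) =
        Real.exp (η / 2 * pastBias E F t H k i σ) := fun k i σ => by
      rw [pastBias_eq_sum_roundBias]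
    have hwc : worstCase E (expWeight E η F t H) t H (x t) (F.kernel t (H, x t)) ≤ ε := by
      -- The minmax value is at most every `κ > 0`, so the slack disappears and only `ε` remains.
      refine le_of_forall_pos_le_add fun κ hκ => ?_
      obtain ⟨ψ, hψ, hle⟩ := exists_worstCase_le E (expWeight E η F t H) t H (x t) hκ
      have := hF t ht H (x t) ψ hψ
      linarith
    have h1 := (hE.integral_payoff_le_worstCase (y t) _).trans hwc
    rw [hE.integral_payoff_eq x p y t] at h1
    simp only [Fintype.sum_prod_type, hw]
    have hWpos : 0 < ∑ k' : K, ∑ i' : Fin d, ∑ σ' : ℤˣ,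
        Real.exp (η / 2 * pastBias E F t H k' i' σ') :=
      Finset.sum_pos (fun _ _ => Finset.sum_pos (fun _ _ => Finset.sum_pos
        (fun _ _ => Real.exp_pos _) ⟨1, Finset.mem_univ _⟩) ⟨i, Finset.mem_univ _⟩)
        ⟨k, Finset.mem_univ _⟩
    rw [← div_le_iff₀ hWpos]
    refine le_trans (le_of_eq ?_) h1
    simp only [Finset.sum_div, expWeight]
    refine Finset.sum_congr rfl fun k _ => Finset.sum_congr rfl fun i _ =>
      Finset.sum_congr rfl fun σ _ => ?_
    simp only [hg]
    ring

end UnbiasedPrediction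

/-! ### Existence of the unbiased-prediction forecaster -/

section Existence

variable {X : Type*} [MeasurableSpace X] {d : ℕ} {K : Type*} [Fintype K] {E : K → Event X d}

omit [MeasurableSpace X] in
lemma IsRegularEvents.exists_near_minimizer (hE : IsRegularEvents E) (q : K → Fin d → ℤˣ → ℝ)
    (t : ℕ) (h : Transcript X d t) (x : X) {ε : ℝ} (hε : 0 < ε) :
    ∃ ψ : Measure (Outcome d), IsProbabilityMeasure ψ ∧
      ∀ ψ' : Measure (Outcome d), IsProbabilityMeasure ψ' →
        worstCase E q t h x ψ ≤ worstCase E q t h x ψ' + ε := by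
  set S : Set ℝ := worstCase E q t h x '' {ψ | IsProbabilityMeasure ψ} with hS
  have hbdd : BddBelow S := by
    refine ⟨-∑ k, ∑ i, ∑ σ, |q k i σ|, ?_⟩
    rintro _ ⟨ψ, hψ, rfl⟩
    have : IsProbabilityMeasure ψ := hψ
    exact hE.le_worstCase ψ
  obtain ⟨y⟩ : Nonempty (Outcome d) := inferInstance
  have hne : S.Nonempty := ⟨_, Measure.dirac y, Measure.dirac.isProbabilityMeasure, rfl⟩
  obtain ⟨_, ⟨ψ, hψ, rfl⟩, hlt⟩ := exists_lt_of_csInf_lt hne (lt_add_of_pos_right (sInf S) hε)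
  refine ⟨ψ, hψ, fun ψ' hψ' => ?_⟩
  have := csInf_le hbdd (Set.mem_image_of_mem (worstCase E q t h x) (show ψ' ∈ _ from hψ'))
  linarith

omit [Fintype K] in
lemma measurable_pastBias
    (hE : ∀ k t, Measurable fun z : (Transcript X d t × X) × Outcome d => E k t z.1.1 z.1.2 z.2)
    (F : Forecaster X d) (t : ℕ) (k : K) (i : Fin d) (σ : ℤˣ) :
    Measurable fun h => pastBias E F t h k i σ := by
  refine Finset.measurable_fun_sum _ fun s _ => Measurable.const_mul ?_ _
  have hs : Measurable fun h : Transcript X d t =>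
      ((Fin.take s s.is_lt.le h : Transcript X d s), (h s).1) :=
    Measurable.prodMk (measurable_pi_lambda _ fun r => measurable_pi_apply _)
      (measurable_pi_apply s).fst
  have := F.markov s
  have hf : Measurable fun z : Transcript X d t × Outcome d =>
      E k s (Fin.take s s.is_lt.le z.1) (z.1 s).1 z.2 *
        ((z.2 : Fin d → ℝ) i - ((z.1 s).2.2 : Fin d → ℝ) i) := by
    refine Measurable.mul ?_ (((measurable_coord i).comp measurable_snd).sub
      ((measurable_coord i).comp ((measurable_pi_apply s).comp measurable_fst).snd.snd))
    exact (hE k s).comp ((hs.comp measurable_fst).prodMk measurable_snd)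
  exact (hf.stronglyMeasurable.integral_kernel_prod_right'
    (κ := (F.kernel s).comap _ hs)).measurable

lemma measurable_expWeight
    (hE : ∀ k t, Measurable fun z : (Transcript X d t × X) × Outcome d => E k t z.1.1 z.1.2 z.2)
    (η : ℝ) (F : Forecaster X d) (t : ℕ) (k : K) (i : Fin d) (σ : ℤˣ) :
    Measurable fun h => expWeight E η F t h k i σ := by
  have hm : ∀ k i σ, Measurable fun h => Real.exp (η / 2 * pastBias E F t h k i σ) :=
    fun k i σ => Real.measurable_exp.comp ((measurable_pastBias hE F t k i σ).const_mul _)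
  exact (hm k i σ).div (Finset.measurable_fun_sum _ fun k _ => Finset.measurable_fun_sum _
    fun i _ => Finset.measurable_fun_sum _ fun σ _ => hm k i σ)

-- Weights of round `t` involve only earlier kernels, so a forecaster can be built round by round.
omit [Fintype K] in
lemma pastBias_congr {F F' : Forecaster X d} {t : ℕ} (hF : ∀ s < t, F.kernel s = F'.kernel s) :
    pastBias E F t = pastBias E F' t := by
  ext h k i σ
  refine Finset.sum_congr rfl fun s _ => ?_
  rw [hF s s.is_lt]

lemma expWeight_congr {F F' : Forecaster X d} {t : ℕ} (hF : ∀ s < t, F.kernel s = F'.kernel s)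
    (η : ℝ) : expWeight E η F t = expWeight E η F' t := by
  ext h k i σ
  simp only [expWeight, pastBias_congr hF]

/-- A measurable near-minimizer for one round, if the events depend on the past through a
measurable statistic with countably many values. -/
lemma IsRegularEvents.exists_kernel (hE : IsRegularEvents E) {t : ℕ} {Γ : Type*} [Countable Γ]
    [MeasurableSpace Γ] [DiscreteMeasurableSpace Γ] {c : Transcript X d t × X → Γ}
    (hc : Measurable c)
    (hfac : ∀ z z' : Transcript X d t × X, c z = c z' → ∀ k, E k t z.1 z.2 = E k t z'.1 z'.2)
    {q : Transcript X d t → K → Fin d → ℤˣ → ℝ} (hq : ∀ k i σ, Measurable fun h => q h k i σ)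
    {ε : ℝ} (hε : 0 < ε) :
    ∃ κ : Kernel (Transcript X d t × X) (Outcome d), IsMarkovKernel κ ∧
      ∀ h x (ψ : Measure (Outcome d)), IsProbabilityMeasure ψ →
        worstCase E (q h) t h x (κ (h, x)) ≤ worstCase E (q h) t h x ψ + ε := by
  classical
  set n : ℝ := ∑ _k : K, ∑ _i : Fin d, ∑ _σ : ℤˣ, (1 : ℝ) with hn
  have hn0 : 0 ≤ n := by positivity
  -- On a grid of mesh `1 / M`, changing the weights costs at most `ε / 4`. This is paid twice, on
  -- top of the `ε / 2` of the near-minimizer.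
  set M : ℝ := 4 * (n + 1) / ε with hM
  have hM0 : 0 < M := by positivity
  let Φ : Transcript X d t × X → Γ × (K → Fin d → ℤˣ → ℤ) := fun z =>
    (c z, fun k i σ => ⌊q z.1 k i σ * M⌋)
  have hΦ : Measurable Φ := hc.prodMk (measurable_pi_lambda _ fun k => measurable_pi_lambda _
    fun i => measurable_pi_lambda _ fun σ =>
      Int.measurable_floor.comp (((hq k i σ).comp measurable_fst).mul_const M))
  choose ψ₀ hψ₀ hmin using fun z : Transcript X d t × X =>
    hE.exists_near_minimizer (q z.1) t z.1 z.2 (half_pos hε)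
  obtain ⟨y⟩ : Nonempty (Outcome d) := inferInstance
  -- One near-minimizer is fixed per cell; as there are countably many cells, the selection is
  -- measurable.
  let sel : Γ × (K → Fin d → ℤˣ → ℤ) → Measure (Outcome d) := fun key =>
    if hk : ∃ z, Φ z = key then ψ₀ hk.choose else Measure.dirac y
  have hsel : ∀ z, ∃ z', Φ z' = Φ z ∧ sel (Φ z) = ψ₀ z' := fun z => by
    have hk : ∃ z', Φ z' = Φ z := ⟨z, rfl⟩
    exact ⟨hk.choose, hk.choose_spec, dif_pos hk⟩
  refine ⟨⟨fun z => sel (Φ z), (measurable_of_countable sel).comp hΦ⟩, ⟨fun z => ?_⟩,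
    fun h x ψ hψ => ?_⟩
  · obtain ⟨z', _, hz'⟩ := hsel z
    change IsProbabilityMeasure (sel (Φ z))
    rw [hz']
    exact hψ₀ z'
  · obtain ⟨z', hkey, hz'⟩ := hsel (h, x)
    change worstCase E (q h) t h x (sel (Φ (h, x))) ≤ _
    rw [hz']
    have hEeq := hfac z' (h, x) (congrArg Prod.fst hkey)
    have hw : ∀ q ψ, worstCase E q t z'.1 z'.2 ψ = worstCase E q t h x ψ := fun q ψ => by
      simp only [worstCase, hEeq]
    have hdiff : ∀ k i σ, |q h k i σ - q z'.1 k i σ| ≤ 1 / M := by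
      intro k i σ
      have h1 : ⌊q z'.1 k i σ * M⌋ = ⌊q h k i σ * M⌋ :=
        congrFun (congrFun (congrFun (congrArg Prod.snd hkey) k) i) σ
      have h2 := Int.abs_sub_lt_one_of_floor_eq_floor h1.symm
      rw [← sub_mul, abs_mul, abs_of_pos hM0] at h2
      exact (le_div_iff₀ hM0).2 h2.le
    have hsum : ∑ k, ∑ i, ∑ σ, |q h k i σ - q z'.1 k i σ| ≤ ε / 4 := by
      calc _ ≤ ∑ _k : K, ∑ _i : Fin d, ∑ _σ : ℤˣ, 1 / M :=
            Finset.sum_le_sum fun k _ => Finset.sum_le_sum fun i _ =>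
              Finset.sum_le_sum fun σ _ => hdiff k i σ
        _ = n / M := by rw [hn]; simp only [Finset.sum_div]
        _ ≤ ε / 4 := by
            rw [hM, div_le_div_iff₀ (by positivity) (by norm_num)]
            field_simp
            linarith
    have h1 := hmin z' ψ hψ
    rw [hw, hw] at h1
    have := hψ₀ z'
    have h2 := hE.worstCase_le_add (q := q h) (q' := q z'.1) (t := t) (h := h) (x := x) (ψ₀ z')
    have h3 := hE.worstCase_le_add (q := q z'.1) (q' := q h) (t := t) (h := h) (x := x) ψ
    simp only [abs_sub_comm (q z'.1 _ _ _)] at h3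
    linarith

/-- Induction on the horizon: the kernel of the new last round is overwritten, which leaves all
weights up to that round unchanged. -/
theorem IsRegularEvents.exists_isUnbiasedPrediction (hE : IsRegularEvents E)
    (hEm : ∀ k t, Measurable fun z : (Transcript X d t × X) × Outcome d => E k t z.1.1 z.1.2 z.2)
    {Γ : Type*} [Countable Γ] [MeasurableSpace Γ] [DiscreteMeasurableSpace Γ]
    (c : ∀ t, Transcript X d t × X → Γ) (hc : ∀ t, Measurable (c t))
    (hfac : ∀ t, ∀ z z' : Transcript X d t × X, c t z = c t z' →
      ∀ k, E k t z.1 z.2 = E k t z'.1 z'.2)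
    (η : ℝ) {ε : ℝ} (hε : 0 < ε) (T : ℕ) :
    ∃ F : Forecaster X d, IsUnbiasedPrediction E η ε T F := by
  induction T with
  | zero =>
    obtain ⟨y⟩ : Nonempty (Outcome d) := inferInstance
    exact ⟨⟨fun _ => Kernel.const _ (Measure.dirac y), fun _ => inferInstance⟩,
      fun t ht => absurd ht (Nat.not_lt_zero t)⟩
  | succ T ih =>
    obtain ⟨F, hF⟩ := ih
    obtain ⟨κ, hκ, hmin⟩ := hE.exists_kernel (hc T) (hfac T)
      (q := expWeight E η F T) (measurable_expWeight hEm η F T) hε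
    let F' : Forecaster X d :=
      { kernel := Function.update F.kernel T κ
        markov := fun t => by
          rcases eq_or_ne t T with rfl | h
          · rwa [Function.update_self]
          · rw [Function.update_of_ne h]; exact F.markov t }
    have hlt : ∀ t < T, F'.kernel t = F.kernel t := fun t ht => Function.update_of_ne ht.ne _ _
    have heq : F'.kernel T = κ := Function.update_self ..
    refine ⟨F', fun t ht h x ψ hψ => ?_⟩
    rw [expWeight_congr (F' := F) fun s hs => hlt s (by omega)]
    rcases Nat.lt_succ_iff_lt_or_eq.1 ht with ht | rfl
    · rw [hlt t ht]; exact hF t ht h x ψ hψ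
    · rw [heq]; exact hmin h x ψ hψ

end Existence

/-! ### Existence of Decision-Calibration-Expectation -/

section DecisionCalibration

variable {X : Type*} {d : ℕ} {A : Type*} [Fintype A] {J : ℕ} {N : Type*} [Fintype N]
  (ag : N → Agent A d J) (br : ∀ i, CBR (ag i).u) (τ : ℝ)

omit [Fintype N] in
lemma isRegularEvents_playEvent : IsRegularEvents (playEvent X ag br τ) where
  measurable k t h x := by
    let _ : MeasurableSpace X := ⊤
    exact (measurable_playEvent ag br τ k t).comp (measurable_const (a := (h, x)) |>.prodMk
      measurable_id)
  abs_le_one k t h x p := by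
    have := playEvent_mem ag br τ k t h x p
    rw [abs_of_nonneg this.1]; exact this.2

local instance {A : Type*} : MeasurableSpace (Finset A) := ⊤

local instance {A : Type*} : DiscreteMeasurableSpace (Finset A) := ⟨fun _ => trivial⟩

/-- The play events depend on the past only through the agents' candidate sets, which form a finite
statistic. -/
theorem exists_isDecisionCalibrationExpectation [MeasurableSpace X] (η : ℝ) {ε : ℝ}
    (hε : 0 < ε) (T : ℕ) :
    ∃ F : Forecaster X d, IsDecisionCalibrationExpectation ag br τ η ε T F := by
  refine (isRegularEvents_playEvent ag br τ).exists_isUnbiasedPrediction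
    (measurable_playEvent ag br τ) (Γ := N → Finset A)
    (fun t z i => (elimState (ag i) (br i) τ t z.1).candidates) (fun t => ?_) ?_ η hε T
  · refine measurable_pi_lambda _ fun i => ?_
    exact measurable_to_countable' fun C =>
      measurable_fst (measurableSet_candidates_eq (ag i) (br i) τ t C)
  · intro t z z' hz k
    ext p
    have h : elimAction (ag k.1) (br k.1) τ t z.1 p = elimAction (ag k.1) (br k.1) τ t z'.1 p :=
      congrArg (fun C => (br k.1).act C p) (congrFun hz k.1)
    unfold playEvent
    rw [h]

end DecisionCalibration

/-! ### Decision calibration of the realized predictions -/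

section Calibration

variable {X : Type*} [MeasurableSpace X] {d : ℕ} {F : Forecaster X d} {T : ℕ}
  {Ω : Type*} [mΩ : MeasurableSpace Ω] {P : Measure Ω} {K : Type*} {E : K → Event X d}

/-- The realized minus the expected bias of the event `k` in round `t` and coordinate `i`. -/
def Interaction.biasDeviation (I : Interaction F T P) (E : K → Event X d) (k : K) (i : Fin d)
    (t : ℕ) (ω : Ω) : ℝ :=
  E k t (I.history t ω) (I.feature t ω) (I.prediction t ω) *
      ((I.prediction t ω : Fin d → ℝ) i - (I.outcome t ω : Fin d → ℝ) i) -
    roundBias E F (fun s => I.feature s ω) (fun s => I.prediction s ω)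
      (fun s => I.outcome s ω) t k i

/-- The expected bias is taken at the realized outcome, so the deviation is centred for each fixed
`y` when the prediction is averaged; independence permits integrating over the prediction first. -/
lemma Interaction.martingaleDiff_biasDeviation [IsProbabilityMeasure P] (I : Interaction F T P)
    (hE : IsRegularEvents E)
    (hEm : ∀ k t, Measurable fun z : (Transcript X d t × X) × Outcome d => E k t z.1.1 z.1.2 z.2)
    (k : K) (i : Fin d) (σ : ℤˣ) :
    MartingaleDiff P I.info T 2 fun t ω => ((σ : ℤ) : ℝ) * I.biasDeviation E k i t ω := by
  have hb : ∀ t (γ : Transcript X d t × X) (r y : Outcome d),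
      |E k t γ.1 γ.2 r * ((r : Fin d → ℝ) i - (y : Fin d → ℝ) i)| ≤ 1 := fun t γ r y => by
    rw [abs_mul]
    exact mul_le_one₀ (hE.abs_le_one _ _ _ _ _) (abs_nonneg _) (r.abs_sub_le y i)
  have hib : ∀ t (γ : Transcript X d t × X) (y : Outcome d),
      |∫ r, E k t γ.1 γ.2 r * ((r : Fin d → ℝ) i - (y : Fin d → ℝ) i) ∂(F.kernel t γ)| ≤ 1 := by
    intro t γ y
    have := F.markov t
    have h1 := norm_integral_le_of_norm_le_const (μ := F.kernel t γ) (C := 1)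
      (f := fun r => E k t γ.1 γ.2 r * ((r : Fin d → ℝ) i - (y : Fin d → ℝ) i))
      (Filter.Eventually.of_forall fun r => hb t γ r y)
    simpa using h1
  let f : ∀ t, ((Transcript X d t × X) × Measure (Outcome d)) × Outcome d × Outcome d → ℝ :=
    fun t q => ((σ : ℤ) : ℝ) *
      (E k t q.1.1.1 q.1.1.2 q.2.1 * ((q.2.1 : Fin d → ℝ) i - (q.2.2 : Fin d → ℝ) i) -
        ∫ r, E k t q.1.1.1 q.1.1.2 r * ((r : Fin d → ℝ) i - (q.2.2 : Fin d → ℝ) i)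
          ∂(F.kernel t q.1.1))
  have hfm : ∀ t, Measurable (f t) := by
    intro t
    have := F.markov t
    refine Measurable.const_mul (Measurable.sub ?_ ?_) _
    · exact ((hEm k t).comp (measurable_fst.fst.prodMk measurable_snd.fst)).mul
        (((measurable_coord i).comp measurable_snd.fst).sub
          ((measurable_coord i).comp measurable_snd.snd))
    · have hg : Measurable fun z : (((Transcript X d t × X) × Measure (Outcome d)) ×
          Outcome d × Outcome d) × Outcome d => E k t z.1.1.1.1 z.1.1.1.2 z.2 *
            ((z.2 : Fin d → ℝ) i - (z.1.2.2 : Fin d → ℝ) i) :=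
        ((hEm k t).comp (measurable_fst.fst.fst.prodMk measurable_snd)).mul
          (((measurable_coord i).comp measurable_snd).sub
            ((measurable_coord i).comp measurable_fst.snd.snd))
      exact (hg.stronglyMeasurable.integral_kernel_prod_right'
        (κ := (F.kernel t).comap _ measurable_fst.fst)).measurable
  have hfb : ∀ t γ q, |f t (γ, q)| ≤ 2 := by
    intro t γ q
    simp only [f]
    rw [abs_mul, abs_units_cast, one_mul]
    exact (abs_sub _ _).trans (by linarith [hb t γ.1 q.1 q.2, hib t γ.1 q.2])
  refine I.martingaleDiff f (fun t _ => hfm t) (fun t _ γ q _ => hfb t γ q) fun t _ γ hγ => ?_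
  have := F.markov t
  rw [integral_prod_symm (fun q => f t (γ, q))
    (integrable_of_abs_le ((hfm t).comp measurable_prodMk_left) (hfb t γ))]
  refine integral_eq_zero_of_ae (Filter.Eventually.of_forall fun y => ?_)
  simp only [f, Pi.zero_apply]
  rw [integral_const_mul, integral_sub (hE.integrable_event k i y _) (integrable_const _)]
  simp

/-- For some event and coordinate, the realized and expected biases differ by more than `l`. -/
def Interaction.biasEvent (I : Interaction F T P) (E : K → Event X d) (l : ℝ) : Set Ω :=
  ⋃ q : K × Fin d × ℤˣ,
    {ω | l < ∑ t ∈ Finset.range T, ((q.2.2 : ℤ) : ℝ) * I.biasDeviation E q.1 q.2.1 t ω}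

lemma Interaction.measure_biasEvent_le [Fintype K] [IsProbabilityMeasure P]
    (I : Interaction F T P) (hE : IsRegularEvents E)
    (hEm : ∀ k t, Measurable fun z : (Transcript X d t × X) × Outcome d => E k t z.1.1 z.1.2 z.2)
    (hT : 0 < T) {l : ℝ} (hl : 0 ≤ l) :
    P (I.biasEvent E l) ≤
      ENNReal.ofReal (Fintype.card K * (d * 2) * Real.exp (-l ^ 2 / (2 * T * 2 ^ 2))) := by
  calc _ ≤ ∑ q : K × Fin d × ℤˣ, ENNReal.ofReal (Real.exp (-l ^ 2 / (2 * T * 2 ^ 2))) :=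
        (measure_iUnion_fintype_le _ _).trans (Finset.sum_le_sum fun q _ =>
          (I.martingaleDiff_biasDeviation hE hEm q.1 q.2.1 q.2.2).measure_sum_gt_le
            two_pos le_rfl hT hl)
    _ = _ := by
        rw [Finset.sum_const, Finset.card_univ, nsmul_eq_mul, ENNReal.ofReal_mul (by positivity),
          ← ENNReal.ofReal_natCast]
        simp [Fintype.card_units_int]

lemma Interaction.abs_sum_biasDeviation_le (I : Interaction F T P) {l : ℝ} {ω : Ω}
    (hω : ω ∉ I.biasEvent E l) (k : K) (i : Fin d) :
    |∑ t ∈ Finset.range T, I.biasDeviation E k i t ω| ≤ l := by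
  have h : ∀ σ : ℤˣ, ((σ : ℤ) : ℝ) * ∑ t ∈ Finset.range T, I.biasDeviation E k i t ω ≤ l := by
    intro σ
    rw [Finset.mul_sum]
    exact not_lt.1 fun hlt => hω (Set.mem_iUnion.2 ⟨(k, i, σ), hlt⟩)
  have h1 := h 1
  have h2 := h (-1)
  simp only [Units.val_one, Int.cast_one, one_mul, Units.val_neg, Int.cast_neg, neg_mul] at h1 h2
  exact abs_le.2 ⟨by linarith, h1⟩

variable {A : Type*} [Fintype A] {J : ℕ} {N : Type*}

/-- The realized bias is the expected bias plus the deviation, and a constant error function is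
enough. -/
lemma Interaction.decisionCalibrated_of_bias_le (I : Interaction F T P) (ag : N → Agent A d J)
    (br : ∀ i, CBR (ag i).u) (τ : ℝ) {l B : ℝ} (hl : 0 ≤ l) (hB : 0 ≤ B) {ω : Ω}
    (hω : ω ∉ I.biasEvent (playEvent X ag br τ) l)
    (hbias : ∀ k i, |∑ t ∈ Finset.range T, roundBias (playEvent X ag br τ) F
      (fun s => I.feature s ω) (fun s => I.prediction s ω) (fun s => I.outcome s ω) t k i| ≤ B) :
    I.DecisionCalibrated ag br τ (fun _ => l + B) ω := by
  intro n a
  rw [pi_norm_le_iff_of_nonneg (by positivity)]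
  intro i
  have h1 := I.abs_sum_biasDeviation_le hω (n, a) i
  have h2 := hbias (n, a) i
  rw [Real.norm_eq_abs]
  refine le_trans (le_of_eq ?_) ((abs_add_le _ _).trans (add_le_add h1 h2))
  rw [← Finset.sum_add_distrib, Finset.sum_apply]
  congr 1
  refine Finset.sum_congr rfl fun t _ => ?_
  simp only [Interaction.biasDeviation, sub_add_cancel, playEvent, ite_mul, one_mul, zero_mul]
  rw [apply_ite (fun z : Fin d → ℝ => z i)]
  rfl

end Calibration

/-! ### The learning rate and the main bounds -/

/-- The learning rate of the forecaster for `m` events in dimension `d` over `T` rounds. -/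
def learningRate (d m T : ℕ) : ℝ :=
  -- The factor 2 undoes the halving in the weights, the minimum keeps the halved rate at most 1,
  -- and the added ones keep it positive even if the logarithm or `T` is zero.
  2 * min 1 √((1 + Real.log (m * (d * 2))) / (T + 1))

lemma one_add_log_pos (d m : ℕ) : 0 < 1 + Real.log ((m : ℝ) * (d * 2)) := by
  have := Real.log_natCast_nonneg (m * (d * 2))
  push_cast at this
  linarith

lemma learningRate_pos (d m T : ℕ) : 0 < learningRate d m T := by
  have := one_add_log_pos d m
  unfold learningRate
  positivity

/-- The bound on the expected bias at the learning rate `learningRate d m T`. -/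
lemma expected_bias_bound {d m T : ℕ} (hdm : 2 ≤ d * m) (hT : 0 < T) {δ ε b : ℝ} (hδ : 0 < δ)
    (hδ1 : δ < 1) (hε : ε ≤ 1 / (T + 1)) (hbT : b ≤ T)
    (hb : b ≤ Real.log (m * (d * 2)) / (learningRate d m T / 2) + ε * T +
      learningRate d m T / 2 * T) :
    b ≤ 7 * √(T * Real.log (d * m * T / δ)) := by
  have hTr : (1 : ℝ) ≤ T := by exact_mod_cast hT
  have hdmr : (2 : ℝ) ≤ d * m := by exact_mod_cast hdm
  set Λ := Real.log (d * m * T / δ) with hΛ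
  set l := Real.log ((m : ℝ) * (d * 2)) with hl
  have hdmΛ : Real.log (d * m) ≤ Λ := by
    refine Real.log_le_log (by positivity) ?_
    rw [le_div_iff₀ hδ]
    have : (d * m : ℝ) * δ ≤ d * m * 1 := by gcongr
    have : (d * m : ℝ) * 1 ≤ d * m * T := by gcongr
    linarith
  have hlog2 : Real.log 2 ≤ Real.log (d * m) := Real.log_le_log (by norm_num) hdmr
  have hlog2' := Real.log_two_gt_d9
  have hleq : l = Real.log 2 + Real.log (d * m) := by
    rw [hl, ← Real.log_mul (by norm_num) (by positivity)]
    congr 1; ring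
  have hl2 : l ≤ 2 * Λ := by linarith
  have hl1 : 1 ≤ l := by linarith
  have hΛ2 : 1 / 2 ≤ Λ := by linarith
  have hΛ0 : 0 ≤ Λ := by linarith
  set S := √(T * Λ) with hS
  have hS0 : 0 ≤ S := Real.sqrt_nonneg _
  have hS2 : S ^ 2 = T * Λ := Real.sq_sqrt (by positivity)
  set e := √((1 + l) / (T + 1)) with he
  have hlr : learningRate d m T / 2 = min 1 e := by
    unfold learningRate; ring
  -- When the rate is capped, `T ≤ l ≤ 2 * Λ`, and the trivial bound `b ≤ T` suffices. Otherwise the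
  -- three terms contribute `3 * S`, `2 * S` and `2 * S`, which add up to 7.
  rcases le_total 1 e with h1 | h1
  · have h2 : 1 ≤ (1 + l) / (T + 1) := by
      rw [← Real.one_le_sqrt]; exact h1
    rw [one_le_div (by positivity)] at h2
    have h3 : (T : ℝ) ≤ 7 * S := by
      refine abs_le_of_sq_le_sq' ?_ (by positivity) |>.2
      rw [mul_pow, hS2]
      nlinarith
    linarith
  · rw [hlr, min_eq_right h1] at hb
    have he0 : 0 < e := Real.sqrt_pos.2 (by positivity)
    have he2 : e ^ 2 = (1 + l) / (T + 1) := Real.sq_sqrt (by positivity)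
    have h2 : ε * T ≤ 2 * S := by
      have h3 : ε * T ≤ 1 / (T + 1) * T := by gcongr
      have h4 : 1 / ((T : ℝ) + 1) * T ≤ 1 := by
        rw [one_div_mul_eq_div, div_le_one (by positivity)]; linarith
      have h5 : 1 ≤ 2 * S := by
        refine abs_le_of_sq_le_sq' ?_ (by positivity) |>.2
        rw [mul_pow, hS2]
        nlinarith
      linarith
    have h3 : e * T ≤ 2 * S := by
      refine abs_le_of_sq_le_sq' ?_ (by positivity) |>.2
      rw [mul_pow, mul_pow, hS2, he2, div_mul_eq_mul_div, div_le_iff₀ (by positivity)]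
      have : (1 + l) * (T : ℝ) ^ 2 ≤ (4 * Λ) * T ^ 2 := by gcongr; linarith
      nlinarith [mul_nonneg (by positivity : (0 : ℝ) ≤ T) hΛ0]
    have h4 : l / e ≤ 3 * S := by
      refine abs_le_of_sq_le_sq' ?_ (by positivity) |>.2
      rw [div_pow, mul_pow, hS2, he2, div_le_iff₀ (by positivity)]
      have h5 : l ^ 2 ≤ (1 + l) * (2 * Λ) := by nlinarith
      have h6 : (T + 1 : ℝ) ≤ 2 * T := by linarith
      rw [mul_div_assoc', le_div_iff₀ (by positivity)]
      calc l ^ 2 * (T + 1) ≤ ((1 + l) * (2 * Λ)) * (2 * T) := by gcongr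
        _ ≤ 3 ^ 2 * (T * Λ) * (1 + l) := by
          nlinarith [mul_nonneg (mul_nonneg (by positivity : (0 : ℝ) ≤ T) hΛ0)
            (by linarith : (0 : ℝ) ≤ 1 + l)]
    linarith

/-- Subadditivity is used instead of complements, so neither set has to be measurable. -/
lemma le_measure_of_compl_subset {Ω : Type*} [MeasurableSpace Ω] {P : Measure Ω}
    [IsProbabilityMeasure P] {bad good : Set Ω} (h : badᶜ ⊆ good) {δ : ℝ} (hδ : 0 ≤ δ)
    (hbad : P bad ≤ ENNReal.ofReal δ) : ENNReal.ofReal (1 - δ) ≤ P good := by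
  rw [ENNReal.ofReal_sub _ hδ, ENNReal.ofReal_one, tsub_le_iff_left]
  calc (1 : ENNReal) = P Set.univ := measure_univ.symm
    _ ≤ P (bad ∪ good) := measure_mono fun ω _ => by
        by_cases hω : ω ∈ bad
        · exact Or.inl hω
        · exact Or.inr (h hω)
    _ ≤ P bad + P good := measure_union_le _ _
    _ ≤ _ := by gcongr

/-! ### High-probability regret bounds -/

section Main

variable {X : Type*} [MeasurableSpace X] {d : ℕ} {F : Forecaster X d} {T : ℕ}
  {Ω : Type*} [mΩ : MeasurableSpace Ω] {P : Measure Ω} [IsProbabilityMeasure P]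
  {A : Type*} [Fintype A] {J : ℕ} {N : Type*} [Fintype N]

lemma Interaction.measure_violationEvent_le_self (I : Interaction F T P) (ag : N → Agent A d J)
    (br : ∀ i, CBR (ag i).u) {δ : ℝ} (hδ : 0 < δ) (hδ1 : δ < 1) :
    P (I.violationEvent ag br (threshold (Fintype.card A) (Fintype.card N) J T δ)) ≤
      ENNReal.ofReal δ := by
  refine (I.measure_violationEvent_le ag br hδ hδ1).trans (ENNReal.ofReal_le_ofReal ?_)
  have h : (Fintype.card A * Fintype.card N * J * T : ℝ) =
      (Fintype.card A * Fintype.card N * J * T : ℕ) := by push_cast; ring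
  rw [h]
  rcases Nat.eq_zero_or_pos (Fintype.card A * Fintype.card N * J * T) with h0 | hpos
  · rw [h0]; simpa using hδ.le
  · have h1 : (1 : ℝ) ≤ (Fintype.card A * Fintype.card N * J * T : ℕ) := by exact_mod_cast hpos
    rw [div_le_iff₀ (by positivity)]
    nlinarith

/-- Two actions make the number of bad events at least 2 or zero, so half of the failure budget is
left for the bias event. -/
lemma Interaction.measure_violationEvent_le_half (I : Interaction F T P) (ag : N → Agent A d J)
    (br : ∀ i, CBR (ag i).u) {δ : ℝ} (hδ : 0 < δ) (hδ1 : δ < 1) (hA : 2 ≤ Fintype.card A) :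
    P (I.violationEvent ag br (threshold (Fintype.card A) (Fintype.card N) J T δ)) ≤
      ENNReal.ofReal (δ / 2) := by
  refine (I.measure_violationEvent_le ag br hδ hδ1).trans (ENNReal.ofReal_le_ofReal ?_)
  have h : (Fintype.card A * Fintype.card N * J * T : ℝ) =
      (Fintype.card A * (Fintype.card N * J * T) : ℕ) := by push_cast; ring
  rw [h]
  rcases Nat.eq_zero_or_pos (Fintype.card N * J * T) with h0 | hpos
  · rw [h0, mul_zero, Nat.cast_zero, div_zero]; positivity
  · have h1 : (2 : ℝ) ≤ (Fintype.card A * (Fintype.card N * J * T) : ℕ) := by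
      exact_mod_cast Nat.mul_le_mul hA hpos
    rw [div_le_iff₀ (by positivity)]
    nlinarith

/-- Deviation `8 * S` and expected bias `7 * S` give calibration with the constant `15 * S`;
doubling gives 30. -/
theorem Interaction.swapRegret_le_of_forecaster (I : Interaction F T P) (ag : N → Agent A d J)
    (br : ∀ i, CBR (ag i).u) {L δ ε : ℝ} (hd : 0 < d) (hδ : 0 < δ) (hδ1 : δ < 1)
    (hlin : ∀ i, LinearUtility (ag i).u) (hlip : ∀ i, LipschitzUtility L (ag i).u)
    (hε : ε ≤ 1 / (T + 1))
    (hF : IsDecisionCalibrationExpectation ag br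
      (threshold (Fintype.card A) (Fintype.card N) J T δ)
      (learningRate d (Fintype.card A * Fintype.card N) T) ε T F) :
    ENNReal.ofReal (1 - δ) ≤ P {ω | ∀ i, (I.benchmark (ag i) ω).Nonempty →
      swapRegret (ag i).u (I.benchmark (ag i) ω) T
          (fun t => I.action (ag i) (br i)
            (threshold (Fintype.card A) (Fintype.card N) J T δ) t ω)
          (fun t => I.outcome t ω) ≤
        30 * (L * Fintype.card A *
          √(T * Real.log (d * Fintype.card A * Fintype.card N * T / δ)))} := by
  classical
  set τ := threshold (Fintype.card A) (Fintype.card N) J T δ with hτ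
  by_cases htriv : T = 0 ∨ Subsingleton A ∨ IsEmpty N
  · refine le_measure_of_compl_subset (bad := ∅) (fun ω _ i ⟨a, _⟩ => ?_) hδ.le (by simp)
    have hL := (hlip i).nonneg hd a
    have h0 : swapRegret (ag i).u (I.benchmark (ag i) ω) T
        (fun t => I.action (ag i) (br i) τ t ω) (fun t => I.outcome t ω) = 0 := by
      rcases htriv with rfl | h | h
      · simp [swapRegret]
      · exact swapRegret_eq_zero_of_subsingleton ..
      · exact h.elim i
    rw [h0]
    positivity
  push Not at htriv
  obtain ⟨hT, hA, hN⟩ := htriv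
  have hT : 0 < T := Nat.pos_of_ne_zero hT
  have hA2 : 2 ≤ Fintype.card A := Fintype.one_lt_card_iff_nontrivial.2 hA
  have hN1 : 1 ≤ Fintype.card N := Fintype.card_pos
  set m := Fintype.card A * Fintype.card N with hm
  have hdm : 2 ≤ d * m := by
    have : 2 * 1 ≤ m := Nat.mul_le_mul hA2 hN1
    nlinarith
  have hΛeq : (d * Fintype.card A * Fintype.card N * T / δ : ℝ) = d * m * T / δ := by
    rw [hm]; push_cast; ring
  rw [hΛeq]
  set S := √(T * Real.log (d * m * T / δ)) with hS
  have hTr : (1 : ℝ) ≤ T := by exact_mod_cast hT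
  have hdmr : (2 : ℝ) ≤ d * m := by exact_mod_cast hdm
  have hreg := isRegularEvents_playEvent (X := X) ag br τ
  have hbad : P (I.violationEvent ag br τ ∪ I.biasEvent (playEvent X ag br τ) (8 * S)) ≤
      ENNReal.ofReal δ := by
    refine (measure_union_le _ _).trans ((add_le_add
      (I.measure_violationEvent_le_half ag br hδ hδ1 hA2)
      ((I.measure_biasEvent_le hreg (measurable_playEvent ag br τ) hT (by positivity)).trans
        (ENNReal.ofReal_le_ofReal (q := δ / 2) ?_))).trans
      (by rw [← ENNReal.ofReal_add (by positivity) (by positivity), add_halves]))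
    set W : ℝ := d * m * T / δ with hW
    have hWd : (d * m : ℝ) ≤ W * δ := by
      rw [hW, div_mul_cancel₀ _ hδ.ne']
      exact le_mul_of_one_le_right (by positivity) hTr
    have hW2 : 2 ≤ W := by
      by_contra hcon
      push Not at hcon
      nlinarith
    -- There are `2 * d * m ≤ 2 * W * δ` bias events, and `4 * W ≤ W ^ 8` because `W ≥ 2`, so their
    -- total probability is at most `δ / 2`.
    have hexp : Real.exp (-(8 * S) ^ 2 / (2 * T * 2 ^ 2)) = 1 / W ^ 8 := by
      rw [mul_pow, hS, Real.sq_sqrt (mul_nonneg (by positivity) (Real.log_nonneg (by linarith)))]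
      have : -(8 ^ 2 * (T * Real.log W)) / (2 * T * 2 ^ 2) = -Real.log (W ^ 8) := by
        rw [Real.log_pow]; field_simp; push_cast; ring
      rw [this, Real.exp_neg, Real.exp_log (by positivity), one_div]
    rw [hexp, Fintype.card_prod, mul_one_div, div_le_iff₀ (by positivity)]
    have h1 : (4 : ℝ) * W ≤ W ^ 8 := by
      have : (2 : ℝ) ^ 7 ≤ W ^ 7 := by gcongr
      calc (4 : ℝ) * W ≤ W ^ 7 * W := by gcongr; linarith
        _ = W ^ 8 := by ring
    have h2 : ((Fintype.card N * Fintype.card A : ℕ) : ℝ) * (d * 2) = 2 * (d * m) := by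
      rw [hm]; push_cast; ring
    rw [h2]
    nlinarith
  refine le_measure_of_compl_subset (fun ω hω i hB => ?_) hδ.le hbad
  rw [Set.mem_compl_iff, Set.mem_union, not_or] at hω
  have hcal := I.decisionCalibrated_of_bias_le ag br τ (B := 7 * S) (by positivity) (by positivity)
    hω.2 fun k j => ?_
  · refine (I.swapRegret_le ag br hd hlin hlip (threshold_nonneg ..)
      (concaveOn_const _ (convex_Ici 0)) hω.1 hcal i hB).trans (le_of_eq ?_)
    ring
  · refine expected_bias_bound hdm hT hδ hδ1 hε ?_ ?_
    · refine (Finset.abs_sum_le_sum_abs _ _).trans ((Finset.sum_le_card_nsmul _ _ 1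
        fun t _ => hreg.abs_roundBias_le _ _ _ t k j).trans (by simp))
    · have h := IsUnbiasedPrediction.abs_sum_roundBias_le hreg (learningRate_pos d m T)
        (by unfold learningRate; linarith [min_le_left 1 √((1 + Real.log (m * (d * 2))) / (T + 1))])
        hF (fun s => I.feature s ω) (fun s => I.prediction s ω) (fun s => I.outcome s ω) k j
      rwa [Fintype.card_prod, mul_comm (Fintype.card N)] at h

end Main

end ConstrainedOmni

end

open ConstrainedOmni in
theorem mainTheorem7 :
    ∃ (C : ℝ) (η ε₀ : ℕ → ℕ → ℕ → ℝ), 0 < C ∧ (∀ d m T, 0 < η d m T ∧ 0 < ε₀ d m T) ∧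
    ∀ (d J T : ℕ) (X A N : Type*) [MeasurableSpace X] [Fintype A] [Fintype N]
      (ag : N → Agent A d J) (br : ∀ i, CBR (ag i).u) (L δ : ℝ),
      0 < d → 0 < δ → δ < 1 →
      (∀ i, LinearUtility (ag i).u) → (∀ i, LipschitzUtility L (ag i).u) →
      let τ := threshold (Fintype.card A) (Fintype.card N) J T δ
      -- decision calibration implies the swap regret bound, for every forecaster
      (∀ (F : Forecaster X d) (Ω : Type*) [MeasurableSpace Ω] (P : Measure Ω)
        [IsProbabilityMeasure P] (I : Interaction F T P) (β : ℝ → ℝ),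
        ConcaveOn ℝ (Set.Ici 0) β →
        ENNReal.ofReal (1 - δ) ≤ P {ω | I.DecisionCalibrated ag br τ β ω →
          ∀ i, (I.benchmark (ag i) ω).Nonempty →
            swapRegret (ag i).u (I.benchmark (ag i) ω) T
                (fun t => I.action (ag i) (br i) τ t ω) (fun t => I.outcome t ω) ≤
              2 * L * Fintype.card A * β (T / Fintype.card A)}) ∧
      -- the forecaster exists, at every positive precision
      (∀ ε : ℝ, 0 < ε → ∃ F : Forecaster X d, IsDecisionCalibrationExpectation ag br τ
        (η d (Fintype.card A * Fintype.card N) T) ε T F) ∧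
      -- and ensures the swap and external regret bounds
      (∀ ε : ℝ, ε ≤ ε₀ d (Fintype.card A * Fintype.card N) T →
        ∀ F : Forecaster X d, IsDecisionCalibrationExpectation ag br τ
          (η d (Fintype.card A * Fintype.card N) T) ε T F →
        ∀ (Ω : Type*) [MeasurableSpace Ω] (P : Measure Ω) [IsProbabilityMeasure P]
          (I : Interaction F T P),
        ENNReal.ofReal (1 - δ) ≤ P {ω | ∀ i, (I.benchmark (ag i) ω).Nonempty →
          swapRegret (ag i).u (I.benchmark (ag i) ω) T
              (fun t => I.action (ag i) (br i) τ t ω) (fun t => I.outcome t ω) ≤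
            C * (L * Fintype.card A *
              √(T * Real.log (d * Fintype.card A * Fintype.card N * T / δ))) ∧
          extRegret (ag i).u (I.benchmark (ag i) ω) T
              (fun t => I.action (ag i) (br i) τ t ω) (fun t => I.outcome t ω) ≤
            C * (L * Fintype.card A *
              √(T * Real.log (d * Fintype.card A * Fintype.card N * T / δ)))}) := by
  -- Precision `1 / (T + 1)` keeps the accumulated optimization error `ε * T` at most 1.
  refine ⟨30, learningRate, fun _ _ T => 1 / (T + 1), by norm_num,
    fun d m T => ⟨learningRate_pos d m T, by positivity⟩, ?_⟩
  intro d J T X A N _ _ _ ag br L δ hd hδ hδ1 hlin hlip τ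
  refine ⟨?_, fun ε hε => exists_isDecisionCalibrationExpectation ag br τ _ hε T, ?_⟩
  · intro F Ω _ P _ I β hβ
    refine le_measure_of_compl_subset (fun ω hω hcal i hB => ?_) hδ.le
      (I.measure_violationEvent_le_self ag br hδ hδ1)
    exact I.swapRegret_le ag br hd hlin hlip (threshold_nonneg ..) hβ hω hcal i hB
  · intro ε hε F hF Ω _ P _ I
    refine (I.swapRegret_le_of_forecaster ag br hd hδ hδ1 hlin hlip hε hF).trans
      (measure_mono fun ω hω i hB => ?_)
    have h := hω i hB
    exact ⟨h, (extRegret_le_swapRegret _ hB T _ _).trans h⟩
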